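/- For a finite simple graph $\Gamma$ let $W_\Gamma$ be the right-angled Coxeter group with presentation graph $\Gamma$ (generators: the vertices, each of order $2$; adjacent vertices commute), with its word metric. Let $\Sigma_\Gamma$ be its Davis complex: the cube complex with vertex set $W_\Gamma$ whose cubes are spanned by the cosets $gW_T$, $T$ a clique of $\Gamma$; the edge between $g$ and $gv$ has color $v$, and vertices carry the path metric of the $1$-skeleton, i.e. the word metric. For a set $S$ of vertices of $\Gamma$, $W_S$ is the subgroup generated by $S$, and a copy of $\Sigma_S$ in $\Sigma_\Gamma$ is a translate $g\Sigma_S$, the subcomplex spanned by a coset $gW_S$. **Proposition.** Let $\Gamma$ be a finite triangle-free graph with a separating join $E*F$; that is, $E,F$ are nonempty disjoint sets of vertices, every vertex of $E$ is adjacent to every vertex of $F$, and $\Gamma\setminus(E*F)$ is disconnected. Let $G$ be a union of connected components of $\Gamma\setminus(E*F)$ and let $H:=(\Gamma\setminus (E*F))\setminus G$. Let $\bar G$ be the union of $F$, $G$ and the neighbors of $G$ in $E$, and let $\bar H$ be the union of $F$, $H$ and the neighbors of $H$ in $E$. Partition $E$ into $$A:=E\cap\bar G\cap\bar H^c,\qquad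 B:=E\cap\bar G^c,\qquad C:=E\cap\bar G\cap\bar H .$$ Suppose that $A$ and $B$ are nonempty and that $C=\{c\}$ is a single vertex. Let $\Gamma'$ be the graph whose vertices are those of $\Gamma$ and one new vertex $d$, and whose edges are exactly the following: * all edges between $E\cup\{d\}$ and $F$; * the edges $x - y$ of $\Gamma$ with $x,y\in\bar G$; * the edges $x - y$ of $\Gamma$ with $x,y\in\bar H$ and $x\neq c\neq y$; * an edge $x - d$ for every edge $x - c$ of $\Gamma$ with $x\in\bar H$. Let $\bar H':=(\bar H\setminus\{c\})\cup\{d\}$. Then $W_\Gamma$ is quasiisometric to $W_{\Gamma'}$. Moreover, there are a quasiisometry $f\colon W_\Gamma\to W_{\Gamma'}$ (viewed as a map between the vertex sets of $\Sigma_\Gamma$ and $\Sigma_{\Gamma'}$) and a constant $R\ge 0$ such that: 1. $f$ sends the vertex set of each copy of $\Sigma_{\bar G}$ in $\Sigma_\Gamma$ to within Hausdorff distance $R$ of that of a copy of $\Sigma_{\bar G}$ in $\Sigma_{\Gamma'}$, and on each copy of $\Sigma_{\bar G}$ in $\Sigma_\Gamma$ the restriction of $f$ is at distance at most $R$ from a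 color preserving cubical isomorphism onto that copy in $\Sigma_{\Gamma'}$; each copy of $\Sigma_{\bar G}$ in $\Sigma_{\Gamma'}$ is within Hausdorff distance $R$ of the $f$-image of a copy of $\Sigma_{\bar G}$ in $\Sigma_\Gamma$. 2. The same holds for the copies of $\Sigma_{\bar H}$ in $\Sigma_\Gamma$ and the copies of $\Sigma_{\bar H'}$ in $\Sigma_{\Gamma'}$, where the cubical isomorphisms send $c$-colored edges to $d$-colored edges and preserve all other colors. -/

import Mathlib

open Set

/-! ### Right-angled Coxeter groups, word metric, Davis complex -/

open Classical in
/-- The right-angled Coxeter matrix of a graph: `1` on the diagonal, `2` on edges and `0`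
(which stands for `∞`) on non-edges. -/
noncomputable def racgMatrix {V : Type*} (Γ : SimpleGraph V) : CoxeterMatrix V where
  M := Matrix.of fun i j => if i = j then 1 else if Γ.Adj i j then 2 else 0
  isSymm := Matrix.IsSymm.ext fun i j => by
    simp only [Matrix.of_apply, Γ.adj_comm j i, eq_comm (a := j) (b := i)]
  diagonal i := by simp
  off_diagonal i j h := by
    simp only [Matrix.of_apply, h, if_false]
    split_ifs <;> simp

/-- The right-angled Coxeter group `W_Γ`. It is also the vertex set of the Davis complex. -/
def RACG {V : Type*} (Γ : SimpleGraph V) : Type _ := (racgMatrix Γ).Group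

namespace RACG

variable {V : Type*} {Γ : SimpleGraph V}

noncomputable instance : Group (RACG Γ) := inferInstanceAs (Group (racgMatrix Γ).Group)

/-- The standard Coxeter system on `W_Γ`. -/
noncomputable def coxeterSystem (Γ : SimpleGraph V) : CoxeterSystem (racgMatrix Γ) (RACG Γ) :=
  (racgMatrix Γ).toCoxeterSystem

/-- The generator of `W_Γ` given by a vertex of `Γ`. -/
noncomputable def gen (Γ : SimpleGraph V) (v : V) : RACG Γ := (coxeterSystem Γ).simple v

/-- The word metric `d(x, y) = ℓ(x⁻¹ y)`. It is the path metric of the 1-skeleton of the Davis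
complex (the Cayley graph), restricted to the vertices. -/
noncomputable instance : MetricSpace (RACG Γ) where
  dist x y := (coxeterSystem Γ).length (x⁻¹ * y)
  dist_self x := by simp
  dist_comm x y := by
    rw [← (coxeterSystem Γ).length_inv (x⁻¹ * y), mul_inv_rev, inv_inv]
  dist_triangle x y z := by
    have h := (coxeterSystem Γ).length_mul_le (x⁻¹ * y) (y⁻¹ * z)
    rw [mul_assoc, mul_inv_cancel_left] at h
    exact_mod_cast h
  eq_of_dist_eq_zero {x y} h := by
    have h' : (coxeterSystem Γ).length (x⁻¹ * y) = 0 := by exact_mod_cast h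
    rw [(coxeterSystem Γ).length_eq_zero_iff] at h'
    exact inv_mul_eq_one.mp h'

theorem dist_def (x y : RACG Γ) : dist x y = (coxeterSystem Γ).length (x⁻¹ * y) := rfl

/-- The special subgroup `W_S` generated by a set `S` of vertices. -/
noncomputable def special (Γ : SimpleGraph V) (S : Set V) : Subgroup (RACG Γ) :=
  Subgroup.closure (gen Γ '' S)

/-- The vertex set of the copy `g Σ_S` of `Σ_S` in the Davis complex `Σ_Γ`: the coset `g W_S`. -/
noncomputable def copy (Γ : SimpleGraph V) (S : Set V) (g : RACG Γ) : Set (RACG Γ) :=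
  {x | g⁻¹ * x ∈ special Γ S}

/-- `Q` is the vertex set of a cube of the Davis complex `Σ_Γ`: a coset of the special subgroup
of a clique (the empty clique gives the vertices, singletons give the edges). -/
def IsCube (Γ : SimpleGraph V) (Q : Set (RACG Γ)) : Prop :=
  ∃ (g : RACG Γ) (T : Set V), Γ.IsClique T ∧ Q = copy Γ T g

end RACG

/-- A bijection `φ` between the vertex sets of copies `g Σ_S ⊆ Σ_Γ` and `g' Σ_S' ⊆ Σ_Γ'` is a
cubical isomorphism (a set of vertices spans a cube exactly when its image does) which sends edges
of color `s` to edges of color `κ s`. -/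
structure IsColoredCubicalIso {V V' : Type*} {Γ : SimpleGraph V} {Γ' : SimpleGraph V'}
    {S : Set V} {S' : Set V'} {g : RACG Γ} {g' : RACG Γ'} (κ : V → V')
    (φ : RACG.copy Γ S g ≃ RACG.copy Γ' S' g') : Prop where
  cube : ∀ Q : Set (RACG.copy Γ S g),
    RACG.IsCube Γ (Subtype.val '' Q) ↔ RACG.IsCube Γ' (Subtype.val '' (φ '' Q))
  color : ∀ x y : RACG.copy Γ S g, ∀ s ∈ S,
    (y : RACG Γ) = x * RACG.gen Γ s ↔ (φ y : RACG Γ') = φ x * RACG.gen Γ' (κ s)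

/-! ### Quasiisometries -/

/-- `f` is a quasiisometry. -/
def IsQuasiIsometry {X Y : Type*} [PseudoMetricSpace X] [PseudoMetricSpace Y] (f : X → Y) : Prop :=
  ∃ L A : ℝ, 1 ≤ L ∧ 0 ≤ A ∧
    (∀ x x', L⁻¹ * dist x x' - A ≤ dist (f x) (f x') ∧ dist (f x) (f x') ≤ L * dist x x' + A) ∧
    ∀ y, ∃ x, dist (f x) y ≤ A

/-- With a uniform constant `R`: every copy of `Σ_S` in `Σ_Γ` is sent by `f` to within Hausdorff
distance `R` of a copy of `Σ_{κ(S)}` in `Σ_Γ'`, and on it `f` is `R`-close to a cubical isomorphism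
onto that copy that changes colors by `κ`; and every copy of `Σ_{κ(S)}` in `Σ_Γ'` is within
Hausdorff distance `R` of the image of a copy of `Σ_S`. -/
def CoarselyPreservesCopies {V V' : Type*} (Γ : SimpleGraph V) (Γ' : SimpleGraph V')
    (S : Set V) (κ : V → V') (f : RACG Γ → RACG Γ') : Prop :=
  ∃ R : ℝ, 0 ≤ R ∧
    (∀ g : RACG Γ, ∃ g' : RACG Γ',
      Metric.hausdorffEDist (f '' RACG.copy Γ S g) (RACG.copy Γ' (κ '' S) g') ≤ ENNReal.ofReal R ∧
      ∃ φ : RACG.copy Γ S g ≃ RACG.copy Γ' (κ '' S) g', IsColoredCubicalIso κ φ ∧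
        ∀ x : RACG.copy Γ S g, dist (f x) (φ x : RACG Γ') ≤ R) ∧
    (∀ g' : RACG Γ', ∃ g : RACG Γ,
      Metric.hausdorffEDist (f '' RACG.copy Γ S g) (RACG.copy Γ' (κ '' S) g') ≤ ENNReal.ofReal R)

/-! ### The graph operation -/

/-- `E * F` is a separating join of `Γ`: `E` and `F` are nonempty and disjoint, every vertex of `E`
is adjacent to every vertex of `F`, and the graph `Γ ∖ (E * F)` is disconnected. -/
structure IsSeparatingJoin {V : Type*} (Γ : SimpleGraph V) (E F : Set V) : Prop where
  left_nonempty : E.Nonempty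
  right_nonempty : F.Nonempty
  disjoint : Disjoint E F
  adj : ∀ e ∈ E, ∀ f ∈ F, Γ.Adj e f
  separating : ¬ (Γ.induce (E ∪ F)ᶜ).Preconnected

/-- `G` is the vertex set of a union of connected components of the subgraph induced on `U`. -/
def IsUnionOfComponents {V : Type*} (Γ : SimpleGraph V) (U G : Set V) : Prop :=
  ∃ 𝒞 : Set (Γ.induce U).ConnectedComponent, G = ⋃ K ∈ 𝒞, Subtype.val '' K.supp

/-- The union of `F`, `G` and the neighbors of `G` in `E`. -/
def joinHull {V : Type*} (Γ : SimpleGraph V) (E F G : Set V) : Set V :=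
  F ∪ G ∪ {e | e ∈ E ∧ ∃ g ∈ G, Γ.Adj e g}

/-- The edges (listed in one orientation) of the unfolded graph. The new vertex `d` is `none`. -/
inductive UnfoldRel {V : Type*} (Γ : SimpleGraph V) (E F Gbar Hbar : Set V) (c : V) :
    Option V → Option V → Prop
  | join {e f : V} : e ∈ E → f ∈ F → UnfoldRel Γ E F Gbar Hbar c (some e) (some f)
  | join_new {f : V} : f ∈ F → UnfoldRel Γ E F Gbar Hbar c none (some f)
  | left {x y : V} : Γ.Adj x y → x ∈ Gbar → y ∈ Gbar →
      UnfoldRel Γ E F Gbar Hbar c (some x) (some y)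
  | right {x y : V} : Γ.Adj x y → x ∈ Hbar → y ∈ Hbar → x ≠ c → y ≠ c →
      UnfoldRel Γ E F Gbar Hbar c (some x) (some y)
  | right_new {x : V} : Γ.Adj x c → x ∈ Hbar → c ∈ Hbar →
      UnfoldRel Γ E F Gbar Hbar c (some x) none

/-- The graph `Γ'` obtained from `Γ` by unfolding `c` into `c` and a new vertex `d = none`. -/
def unfoldGraph {V : Type*} (Γ : SimpleGraph V) (E F Gbar Hbar : Set V) (c : V) :
    SimpleGraph (Option V) :=
  SimpleGraph.fromRel (UnfoldRel Γ E F Gbar Hbar c)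

open Classical in
/-- The change of colors that sends `c` to `d = none` and fixes every other vertex. -/
noncomputable def recolor {V : Type*} (c : V) : V → Option V :=
  fun v => if v = c then none else some v

/-!
Let `M` and `N` be the special subgroups of the two pieces of `Γ`, where `M` belongs to `Gbar` and
`N` belongs to `Hbar` together with the vertices of `E` that have no neighbour in `G`. The pieces
meet in `F ∪ {c}`, every edge lies in one of them, and `c` is joined to all of `F`. Hence `W_Γ` is
the amalgam of `M` and `N` over `J = W_F × ⟨c⟩`. In the unfolded graph the same two pieces are
glued along `F` only, so its Coxeter group `W'` is the amalgam of `M` and `N` over `K = W_F`. A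
vertex of `A` and a vertex of `B` generate with `c` infinite dihedral groups in `M` and `N` that
centralize `K`.

The normal form theorem describes the Bass-Serre tree of `W_Γ` by words: a child of a coset of one
factor corresponds to a nontrivial coset of `J` in it. In the tree of `W'` a child corresponds to a
nontrivial coset of `K`, and each coset of `J` consists of two cosets of `K`. Therefore every coset
needs about twice as many children as it has. The missing ones are taken from nearby descendants: a
coset receives one grandchild of each of its children but one. A Hilbert hotel shift along the
powers of `a c`, where `a` is a vertex of `A` or `B`, closes the gaps that arise in this way
(`FoldData.Step`). All of this moves points of `W_Γ` by right multiplication by bounded products of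
`a`, `b` and `c`, which commute with `K`.

So there is a permutation `σ` of the set `W_Γ` that commutes with right multiplication by `K`
(`FoldData.exists_isFolding`). Let `M` act on `W_Γ` by right multiplication and `N` by right
multiplication conjugated by `σ`. These actions agree on `K` and give an action of `W'`. It is
simply transitive: free by ping-pong (`FoldData.IsFolding.eq_one_of_fix`), and transitive because
parents have shorter words (`FoldData.IsFolding.exists_apply_eq`). The orbit map yields a bijection
from `W_Γ` to `W'` that is equivariant for `M`, and its composition with the inverse of `σ` is
equivariant for `N`. The two bijections, and their inverses, are at bounded distance
(`RACG.exists_matching`). This makes the first one bilipschitz and coarsely preserves the copies of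
both kinds, because an equivariant bijection restricts to colored cubical isomorphisms
(`RACG.exists_isColoredCubicalIso`).
-/

/-! ### Right-angled Coxeter groups and their special subgroups -/

namespace RACG

variable {V : Type*} {Γ : SimpleGraph V}

theorem gen_mul_self (v : V) : gen Γ v * gen Γ v = 1 :=
  (coxeterSystem Γ).simple_mul_simple_self v

theorem gen_inv (v : V) : (gen Γ v)⁻¹ = gen Γ v :=
  (coxeterSystem Γ).inv_simple v

theorem gen_comm {v w : V} (h : Γ.Adj v w) : gen Γ v * gen Γ w = gen Γ w * gen Γ v := by
  have h1 : (gen Γ v * gen Γ w) ^ (racgMatrix Γ).M v w = 1 :=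
    (coxeterSystem Γ).simple_mul_simple_pow v w
  have h2 : (racgMatrix Γ).M v w = 2 := by
    simp [racgMatrix, h, h.ne]
  rw [h2, pow_two] at h1
  have h3 := eq_inv_of_mul_eq_one_left h1
  rwa [mul_inv_rev, gen_inv, gen_inv] at h3

/-- The universal property of `W_Γ`: a map to a group that sends vertices to elements of order
at most two, adjacent vertices to commuting elements, extends to a homomorphism. -/
theorem exists_hom {H : Type*} [Group H] (f : V → H) (hsq : ∀ v, f v * f v = 1)
    (hcomm : ∀ v w, Γ.Adj v w → f v * f w = f w * f v) :
    ∃ φ : RACG Γ →* H, ∀ v, φ (gen Γ v) = f v := by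
  have hf : (racgMatrix Γ).IsLiftable f := by
    intro v w
    by_cases hvw : v = w
    · subst hvw; simp [hsq]
    · by_cases hadj : Γ.Adj v w
      · have h2 : (racgMatrix Γ).M v w = 2 := by simp [racgMatrix, hadj, hvw]
        rw [h2, pow_two]
        nth_rewrite 2 [hcomm v w hadj]
        rw [mul_assoc, ← mul_assoc (f w), hsq, one_mul, hsq]
      · have h2 : (racgMatrix Γ).M v w = 0 := by simp [racgMatrix, hadj, hvw]
        rw [h2, pow_zero]
  exact ⟨(coxeterSystem Γ).lift ⟨f, hf⟩, fun v => (coxeterSystem Γ).lift_apply_simple hf v⟩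

theorem gen_mem_special {S : Set V} {v : V} (h : v ∈ S) : gen Γ v ∈ special Γ S :=
  Subgroup.subset_closure ⟨v, h, rfl⟩

theorem special_mono {S T : Set V} (h : S ⊆ T) : special Γ S ≤ special Γ T :=
  Subgroup.closure_mono (image_mono h)

open Classical in
/-- The retraction of `W_Γ` that kills the vertices outside `S`. -/
theorem exists_retraction (Γ : SimpleGraph V) (S : Set V) :
    ∃ φ : RACG Γ →* RACG Γ, ∀ v, φ (gen Γ v) = if v ∈ S then gen Γ v else 1 := by
  refine exists_hom _ (fun v => ?_) fun v w h => ?_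
  · split_ifs <;> simp [gen_mul_self]
  · split_ifs <;> simp [gen_comm h]

/-- An element of two special subgroups lies in the special subgroup of the intersection. -/
theorem mem_special_inter {S T : Set V} {x : RACG Γ} (hS : x ∈ special Γ S)
    (hT : x ∈ special Γ T) : x ∈ special Γ (S ∩ T) := by
  obtain ⟨φ, hφ⟩ := exists_retraction Γ S
  have h1 : ∀ y ∈ special Γ S, φ y = y := by
    intro y hy
    induction hy using Subgroup.closure_induction with
    | mem y hy => obtain ⟨v, hv, rfl⟩ := hy; simp [hφ, hv]
    | one => simp
    | mul y z _ _ h1 h2 => simp [h1, h2]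
    | inv y _ h => simp [h]
  have h2 : ∀ y ∈ special Γ T, φ y ∈ special Γ (S ∩ T) := by
    intro y hy
    induction hy using Subgroup.closure_induction with
    | mem y hy =>
      obtain ⟨v, hv, rfl⟩ := hy
      rw [hφ]
      split_ifs with h
      · exact gen_mem_special ⟨h, hv⟩
      · exact one_mem _
    | one => simp
    | mul y z _ _ h1 h2 => rw [map_mul]; exact mul_mem h1 h2
    | inv y _ h => rw [map_inv]; exact inv_mem h
  rw [← h1 x hS]
  exact h2 x hT

theorem gen_ne_one (v : V) : gen Γ v ≠ 1 := by
  intro h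
  obtain ⟨φ, hφ⟩ := exists_hom (Γ := Γ) (H := ℤˣ) (fun _ => -1) (by simp) (by simp)
  have := hφ v
  rw [h, map_one] at this
  exact absurd this (by decide)

theorem gen_mem_special_iff {S : Set V} {v : V} : gen Γ v ∈ special Γ S ↔ v ∈ S := by
  refine ⟨fun h => ?_, gen_mem_special⟩
  by_contra hv
  have h1 := mem_special_inter h (gen_mem_special (Γ := Γ) (mem_singleton v))
  rw [inter_singleton_eq_empty.mpr hv, special, image_empty, Subgroup.closure_empty,
    Subgroup.mem_bot] at h1
  exact gen_ne_one v h1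

theorem dist_mul_gen (x : RACG Γ) (v : V) : dist x (x * gen Γ v) = 1 := by
  rw [dist_def, inv_mul_cancel_left]
  exact_mod_cast (coxeterSystem Γ).length_simple v

/-- A map that moves neighbouring vertices of the Cayley graph by at most `L` is `L`-Lipschitz. -/
theorem dist_le_mul_of_gen {X : Type*} [PseudoMetricSpace X] {f : RACG Γ → X} {L : ℝ}
    (h : ∀ x v, dist (f x) (f (x * gen Γ v)) ≤ L) (x y : RACG Γ) :
    dist (f x) (f y) ≤ L * dist x y := by
  obtain ⟨ω, hω, hxy⟩ := (coxeterSystem Γ).exists_isReduced (x⁻¹ * y)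
  have key : ∀ (ω : List V) (x : RACG Γ),
      dist (f x) (f (x * (coxeterSystem Γ).wordProd ω)) ≤ L * ω.length := by
    intro ω
    induction ω with
    | nil => intro x; simp
    | cons v ω ih =>
      intro x
      rw [CoxeterSystem.wordProd_cons, ← mul_assoc, List.length_cons]
      push_cast
      have h1 := ih (x * gen Γ v)
      have h2 := h x v
      have h3 := dist_triangle (f x) (f (x * gen Γ v))
        (f (x * gen Γ v * (coxeterSystem Γ).wordProd ω))
      have h4 : (coxeterSystem Γ).simple v = gen Γ v := rfl
      rw [h4]
      linarith
  have h1 := key ω x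
  rw [← hxy, mul_inv_cancel_left] at h1
  rwa [dist_def, hxy, hω.eq]

end RACG

/-! ### Normal forms in an amalgam -/

/-- A group `W` with two subgroups `G true`, `G false`, generating `W` and meeting in
`J = K × {1, c}`, with elements `a b ∈ G b` such that `a b` and `c` centralize `K` and the powers of `a b * c`
lie in different cosets of `J`. That `G true` and `G false` generate `W` is stated as an induction
principle. -/
structure FoldData (W : Type*) [Group W] where
  G : Bool → Subgroup W
  J : Subgroup W
  K : Subgroup W
  a : Bool → W
  c : W
  J_le : ∀ b, J ≤ G b
  K_le : K ≤ J
  inter : ∀ b x, x ∈ G b → x ∈ G (!b) → x ∈ J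
  gen : ∀ P : W → Prop, P 1 → (∀ b, ∀ g ∈ G b, ∀ x, P x → P (x * g)) → ∀ x, P x
  a_mem : ∀ b, a b ∈ G b
  c_mem : c ∈ J
  c_notMem : c ∉ K
  c_sq : c * c = 1
  J_cases : ∀ j ∈ J, j ∈ K ∨ c * j ∈ K
  a_comm : ∀ b, ∀ k ∈ K, k * a b = a b * k
  c_comm : ∀ k ∈ K, k * c = c * k
  pow_indep : ∀ b (n : ℕ), (a b * c) ^ n ∈ J → n = 0

namespace FoldData

variable {W : Type*} [Group W] (D : FoldData W)

/-- The element `a b * c` of infinite order along which letters are shifted. -/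
def r (b : Bool) : W := D.a b * D.c

theorem c_mem_G (b : Bool) : D.c ∈ D.G b := D.J_le b D.c_mem

theorem r_mem (b : Bool) : D.r b ∈ D.G b := mul_mem (D.a_mem b) (D.c_mem_G b)

theorem r_comm (b : Bool) {k : W} (hk : k ∈ D.K) : k * D.r b = D.r b * k := by
  rw [r, ← mul_assoc, D.a_comm b k hk, mul_assoc, D.c_comm k hk, mul_assoc]

theorem mk_pow_inj (b : Bool) {m n : ℕ} (h : ((D.r b ^ m : W) : W ⧸ D.J) = (D.r b ^ n : W)) :
    m = n := by
  wlog hmn : m ≤ n generalizing m n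
  · exact (this h.symm (le_of_not_ge hmn)).symm
  obtain ⟨d, rfl⟩ := Nat.exists_eq_add_of_le hmn
  rw [QuotientGroup.eq, pow_add, inv_mul_cancel_left] at h
  have := D.pow_indep b d h
  omega

open Classical in
/-- Representatives of the left cosets of `J`; the powers of `r b` represent their cosets. -/
noncomputable def tr (b : Bool) (q : W ⧸ D.J) : W :=
  if h : ∃ n : ℕ, ((D.r b ^ n : W) : W ⧸ D.J) = q then D.r b ^ h.choose else q.out

theorem mk_tr (b : Bool) (q : W ⧸ D.J) : (D.tr b q : W ⧸ D.J) = q := by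
  rw [tr]
  split_ifs with h
  · exact h.choose_spec
  · exact QuotientGroup.out_eq' q

theorem tr_pow (b : Bool) (n : ℕ) : D.tr b (D.r b ^ n : W) = D.r b ^ n := by
  have h : ∃ m : ℕ, ((D.r b ^ m : W) : W ⧸ D.J) = (D.r b ^ n : W) := ⟨n, rfl⟩
  rw [tr, dif_pos h, D.mk_pow_inj b h.choose_spec]

/-- `t` is the chosen representative of a coset of `J` in `G b`. -/
def IsRep (b : Bool) (t : W) : Prop := t ∈ D.G b ∧ D.tr b (t : W ⧸ D.J) = t

/-- The representative of the coset of `h`. -/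
noncomputable def rp (b : Bool) (h : W) : W := D.tr b (h : W ⧸ D.J)

theorem rp_inv_mul (b : Bool) (h : W) : (D.rp b h)⁻¹ * h ∈ D.J := by
  rw [← QuotientGroup.eq]; exact D.mk_tr b h

theorem rp_mem (b : Bool) {h : W} (hh : h ∈ D.G b) : D.rp b h ∈ D.G b := by
  have h1 := mul_mem hh (inv_mem (D.J_le b (D.rp_inv_mul b h)))
  simpa using h1

theorem isRep_rp (b : Bool) {h : W} (hh : h ∈ D.G b) : D.IsRep b (D.rp b h) :=
  ⟨D.rp_mem b hh, by rw [rp, D.mk_tr]⟩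

theorem isRep_pow (b : Bool) (n : ℕ) : D.IsRep b (D.r b ^ n) :=
  ⟨pow_mem (D.r_mem b) n, D.tr_pow b n⟩

theorem isRep_one (b : Bool) : D.IsRep b 1 := by simpa using D.isRep_pow b 0

theorem isRep_r (b : Bool) : D.IsRep b (D.r b) := by simpa using D.isRep_pow b 1

variable {D} in
theorem IsRep.rp_mul {b : Bool} {t j : W} (ht : D.IsRep b t) (hj : j ∈ D.J) :
    D.rp b (t * j) = t := by
  have h : ((t * j : W) : W ⧸ D.J) = t := by
    rw [QuotientGroup.mk_mul_of_mem _ hj]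
  rw [rp, h, ht.2]

variable {D} in
theorem IsRep.eq_one {b : Bool} {t : W} (ht : D.IsRep b t) (hJ : t ∈ D.J) : t = 1 := by
  have h1 := ht.rp_mul (inv_mem hJ)
  rw [mul_inv_cancel] at h1
  have h2 := (D.isRep_one b).rp_mul (one_mem D.J)
  rw [mul_one] at h2
  rw [← h1, h2]

/-- The word `w`, whose head is its last letter, describes a coset of `G b`: the letters are
nontrivial representatives that belong alternately to `G (!b)`, `G b`, ... -/
def Wd : Bool → List W → Prop
  | _, [] => True
  | b, t :: w => (D.IsRep (!b) t ∧ t ≠ 1) ∧ Wd (!b) w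

/-- The product of a word, whose head is its last letter. -/
def pr : List W → W
  | [] => 1
  | t :: w => pr w * t

variable {D}

theorem Wd.cons {b : Bool} {w : List W} {t : W} (hw : D.Wd b w) (ht : D.IsRep b t)
    (h1 : t ≠ 1) : D.Wd (!b) (t :: w) := by
  simp only [Wd, Bool.not_not]
  exact ⟨⟨ht, h1⟩, hw⟩

theorem Wd.exists_cons {b : Bool} {w : List W} (hw : D.Wd b w) (h : w ≠ []) :
    ∃ t v, w = t :: v ∧ D.IsRep (!b) t ∧ t ≠ 1 ∧ D.Wd (!b) v := by
  cases w with
  | nil => exact absurd rfl h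
  | cons t v => exact ⟨t, v, rfl, hw.1.1, hw.1.2, hw.2⟩

theorem Wd.not_cons {b : Bool} {w : List W} {t : W} (ht : D.IsRep b t) (h1 : t ≠ 1) :
    ¬ D.Wd b (t :: w) := fun h =>
  h1 (ht.eq_one (D.inter b t ht.1 h.1.1.1))

/-- The normal form of `pr v * h`, where `v` describes a coset of `G b` and `h ∈ G b`. -/
noncomputable def push (D : FoldData W) (b : Bool) (v : List W) (h : W) : List W × W :=
  open Classical in
  if h ∈ D.J then (v, h) else (D.rp b h :: v, (D.rp b h)⁻¹ * h)

/-- The inverse of `push`: the normal form `(w, j)` is rewritten as a word for a coset of `G b` and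
an element of `G b`, by moving the last letter of `w` to `j` if it belongs to `G b`. -/
noncomputable def split (D : FoldData W) (b : Bool) (x : List W × W) : List W × W :=
  open Classical in
  if D.Wd b x.1 then x else match x.1 with
    | [] => x
    | t :: v => (v, t * x.2)

/-- Normal forms: a word for either of the two types of cosets, and an element of `J`. -/
def IsNF (D : FoldData W) (x : List W × W) : Prop := (∃ b, D.Wd b x.1) ∧ x.2 ∈ D.J

theorem Wd.isNF {b : Bool} {w : List W} {j : W} (hw : D.Wd b w) (hj : j ∈ D.J) :
    D.IsNF (w, j) := ⟨⟨b, hw⟩, hj⟩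

theorem rp_ne_one {b : Bool} {h : W} (hJ : h ∉ D.J) : D.rp b h ≠ 1 := by
  intro h1
  have := D.rp_inv_mul b h
  rw [h1, inv_one, one_mul] at this
  exact hJ this

theorem isNF_push {b : Bool} {v : List W} {h : W} (hv : D.Wd b v) (hh : h ∈ D.G b) :
    D.IsNF (push D b v h) := by
  rw [push]
  split_ifs with hJ
  · exact ⟨⟨b, hv⟩, hJ⟩
  · exact ⟨⟨!b, hv.cons (D.isRep_rp b hh) (rp_ne_one hJ)⟩, D.rp_inv_mul b h⟩

theorem split_push {b : Bool} {v : List W} {h : W} (hv : D.Wd b v) (hh : h ∈ D.G b) :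
    split D b (push D b v h) = (v, h) := by
  rw [push]
  split_ifs with hJ
  · rw [split, if_pos hv]
  · rw [split, if_neg (Wd.not_cons (D.isRep_rp b hh) (rp_ne_one hJ))]
    simp

theorem IsRep.mul_notMem {b : Bool} {t j : W} (ht : D.IsRep b t) (h1 : t ≠ 1) (hj : j ∈ D.J) :
    t * j ∉ D.J := fun h => h1 (ht.eq_one (by simpa using mul_mem h (inv_mem hj)))

theorem push_of_mem {b : Bool} {v : List W} {j : W} (hj : j ∈ D.J) : push D b v j = (v, j) := by
  rw [push, if_pos hj]

theorem push_cons {b : Bool} {v : List W} {t j : W} (ht : D.IsRep b t) (h1 : t ≠ 1)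
    (hj : j ∈ D.J) : push D b v (t * j) = (t :: v, j) := by
  rw [push, if_neg (ht.mul_notMem h1 hj), ht.rp_mul hj, inv_mul_cancel_left]

theorem IsNF.cases (b : Bool) {x : List W × W} (hx : D.IsNF x) :
    (D.Wd b x.1 ∧ split D b x = x) ∨
      ∃ t v j, x = (t :: v, j) ∧ D.IsRep b t ∧ t ≠ 1 ∧ D.Wd b v ∧ j ∈ D.J ∧
        split D b x = (v, t * j) := by
  obtain ⟨w, j⟩ := x
  by_cases hw : D.Wd b w
  · left; exact ⟨hw, by rw [split, if_pos hw]⟩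
  · right
    obtain ⟨⟨b', hb'⟩, hj⟩ := hx
    have hbb : b' = !b := by
      cases b' <;> cases b <;> simp_all
    subst hbb
    have hne : w ≠ [] := by rintro rfl; exact hw trivial
    obtain ⟨t, v, rfl, ht, h1, hv⟩ := hb'.exists_cons hne
    rw [Bool.not_not] at ht hv
    refine ⟨t, v, j, rfl, ht, h1, hv, hj, ?_⟩
    rw [split, if_neg hw]

theorem IsNF.split_spec (b : Bool) {x : List W × W} (hx : D.IsNF x) :
    D.Wd b (split D b x).1 ∧ (split D b x).2 ∈ D.G b ∧
      push D b (split D b x).1 (split D b x).2 = x := by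
  rcases hx.cases b with ⟨h, hs⟩ | ⟨t, v, j, rfl, ht, h1, hv, hj, hs⟩
  · rw [hs]
    exact ⟨h, D.J_le b hx.2, push_of_mem hx.2⟩
  · rw [hs]
    exact ⟨hv, mul_mem ht.1 (D.J_le b hj), push_cons ht h1 hj⟩

theorem pr_push (b : Bool) (v : List W) (h : W) :
    pr (push D b v h).1 * (push D b v h).2 = pr v * h := by
  rw [push]
  split_ifs <;> simp [pr, mul_assoc]

theorem exists_isNF (D : FoldData W) (x : W) : ∃ y, D.IsNF y ∧ pr y.1 * y.2 = x := by
  refine D.gen (fun x => ∃ y, D.IsNF y ∧ pr y.1 * y.2 = x)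
    ⟨([], 1), Wd.isNF (b := true) trivial (one_mem _), by simp [pr]⟩ ?_ x
  rintro b g hg _ ⟨y, hy, rfl⟩
  obtain ⟨h1, h2, h3⟩ := hy.split_spec b
  refine ⟨push D b (split D b y).1 ((split D b y).2 * g), isNF_push h1 (mul_mem h2 hg), ?_⟩
  have h4 := pr_push (D := D) b (split D b y).1 (split D b y).2
  rw [h3] at h4
  rw [pr_push, ← mul_assoc, ← h4]

/-- Right multiplication by `G b` on normal forms, as a left action. -/
noncomputable def act (D : FoldData W) (b : Bool) : D.G b →* Equiv.Perm {x // D.IsNF x} :=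
  let f : D.G b → {x // D.IsNF x} → {x // D.IsNF x} := fun g x =>
    ⟨push D b (split D b x.1).1 ((split D b x.1).2 * (g : W)⁻¹),
      isNF_push (x.2.split_spec b).1 (mul_mem (x.2.split_spec b).2.1 (inv_mem g.2))⟩
  have hf : ∀ g h x, f g (f h x) = f (g * h) x := fun g h x => by
    apply Subtype.ext
    simp only [f]
    rw [split_push (x.2.split_spec b).1 (mul_mem (x.2.split_spec b).2.1 (inv_mem h.2))]
    simp [mul_assoc]
  have h1 : ∀ x, f 1 x = x := fun x => by
    apply Subtype.ext
    simp only [f]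
    simpa using (x.2.split_spec b).2.2
  { toFun := fun g => ⟨f g, f g⁻¹, fun x => by rw [hf, inv_mul_cancel, h1],
      fun x => by rw [hf, mul_inv_cancel, h1]⟩
    map_one' := by ext1 x; exact h1 x
    map_mul' := fun g h => by ext1 x; exact (hf g h x).symm }

theorem coe_act (b : Bool) (g : D.G b) (x : {x // D.IsNF x}) :
    (act D b g x : List W × W) = push D b (split D b x.1).1 ((split D b x.1).2 * (g : W)⁻¹) := rfl

theorem act_J (b : Bool) {j : W} (hj : j ∈ D.J) (x : {x // D.IsNF x}) :
    (act D b ⟨j, D.J_le b hj⟩ x : List W × W) = (x.1.1, x.1.2 * j⁻¹) := by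
  rw [coe_act]
  rcases x.2.cases b with ⟨h, hs⟩ | ⟨t, v, i, hx, ht, h1, hv, hi, hs⟩
  · rw [hs, push_of_mem (mul_mem x.2.2 (inv_mem hj))]
  · rw [hs, hx, mul_assoc, push_cons ht h1 (mul_mem hi (inv_mem hj))]

/-- `W` is the amalgam of `G true` and `G false` over `J`: permutation representations of the two
subgroups that agree on `J` extend to `W`. Only this case of the universal property is needed, and
only in the universe of `W`. -/
def IsUniversal.{u} {W : Type u} [Group W] (D : FoldData W) : Prop :=
  ∀ (Ω : Type u) (α : ∀ b, D.G b →* Equiv.Perm Ω),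
    (∀ j (hj : j ∈ D.J), α true ⟨j, D.J_le _ hj⟩ = α false ⟨j, D.J_le _ hj⟩) →
    ∃ ρ : W →* Equiv.Perm Ω, ∀ b (g : D.G b), ρ g = α b g

/-- Uniqueness of normal forms: the action of `W` on normal forms recovers the normal form of an
element from the element. -/
theorem exists_nf (hD : D.IsUniversal) :
    ∃ N : W → List W × W, ∀ x, D.IsNF x → N (pr x.1 * x.2) = x := by
  obtain ⟨ρ, hρ⟩ := hD _ (act D) (by
    intro j hj
    ext1 x
    apply Subtype.ext
    rw [act_J _ hj, act_J _ hj])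
  have hcons : ∀ (x y : {x // D.IsNF x}) b (g : W) (hg : g ∈ D.G b),
      push D b (split D b x.1).1 ((split D b x.1).2 * g) = y.1 → ρ g⁻¹ x = y := by
    intro x y b g hg h
    have := hρ b ⟨g⁻¹, inv_mem hg⟩
    apply Subtype.ext
    rw [show ρ g⁻¹ = _ from this, coe_act]
    simpa using h
  let o : {x // D.IsNF x} := ⟨([], 1), Wd.isNF (b := true) trivial (one_mem _)⟩
  have hJ : ∀ w b, D.Wd b w → ∀ j (hj : j ∈ D.J) (hn : D.IsNF (w, 1)) (hn' : D.IsNF (w, j)),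
      ρ j⁻¹ ⟨(w, 1), hn⟩ = ⟨(w, j), hn'⟩ := by
    intro w b hw j hj hn hn'
    apply hcons _ _ b j (D.J_le b hj)
    rw [show split D b (w, 1) = (w, 1) by rw [split, if_pos hw]]
    simp [push_of_mem hj]
  have key : ∀ w b (hw : D.Wd b w), ρ (pr w)⁻¹ o = ⟨(w, 1), hw.isNF (one_mem _)⟩ := by
    intro w
    induction w with
    | nil => intro b hw; simp [pr, o]
    | cons t v ih =>
      intro b hw
      rw [pr, mul_inv_rev, map_mul, Equiv.Perm.mul_apply, ih (!b) hw.2]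
      apply hcons _ _ (!b) t hw.1.1.1
      rw [show split D (!b) (v, 1) = (v, 1) by rw [split, if_pos hw.2]]
      have := push_cons (v := v) hw.1.1 hw.1.2 (one_mem D.J)
      simpa using this
  refine ⟨fun g => (ρ g⁻¹ o : List W × W), ?_⟩
  rintro ⟨w, j⟩ ⟨⟨b, hw⟩, hj⟩
  simp only at hw hj ⊢
  rw [mul_inv_rev, map_mul, Equiv.Perm.mul_apply, key w b hw,
    hJ w b hw j hj (hw.isNF (one_mem _)) (hw.isNF hj)]

theorem nf_inj (hD : D.IsUniversal) {b b' : Bool} {w w' : List W} {j j' : W} (hw : D.Wd b w)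
    (hw' : D.Wd b' w') (hj : j ∈ D.J) (hj' : j' ∈ D.J) (h : pr w * j = pr w' * j') :
    w = w' ∧ j = j' := by
  obtain ⟨N, hN⟩ := exists_nf hD
  have h1 := hN (w, j) ⟨⟨b, hw⟩, hj⟩
  have h2 := hN (w', j') ⟨⟨b', hw'⟩, hj'⟩
  simp only at h1 h2
  rw [h, h2] at h1
  simpa [eq_comm] using h1

/-- Uniqueness of the coordinates with respect to the cosets of `G b`. -/
theorem coset_inj (hD : D.IsUniversal) {b : Bool} {v v' : List W} {h h' : W} (hv : D.Wd b v)
    (hv' : D.Wd b v') (hh : h ∈ D.G b) (hh' : h' ∈ D.G b) (e : pr v * h = pr v' * h') :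
    v = v' ∧ h = h' := by
  obtain ⟨N, hN⟩ := exists_nf hD
  have h1 := hN _ (isNF_push hv hh)
  have h2 := hN _ (isNF_push hv' hh')
  rw [pr_push] at h1 h2
  rw [e, h2] at h1
  have h3 := congrArg (split D b) h1
  rw [split_push hv hh, split_push hv' hh'] at h3
  simpa [eq_comm] using h3

theorem exists_coset (D : FoldData W) (b : Bool) (x : W) :
    ∃ v h, D.Wd b v ∧ h ∈ D.G b ∧ x = pr v * h := by
  obtain ⟨y, hy, rfl⟩ := D.exists_isNF x
  obtain ⟨h1, h2, h3⟩ := hy.split_spec b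
  have h4 := pr_push (D := D) b (split D b y).1 (split D b y).2
  rw [h3] at h4
  exact ⟨_, _, h1, h2, h4⟩

end FoldData

namespace FoldData

variable {W : Type*} [Group W] (D : FoldData W)

/-! ### Shifting letters -/

open Classical in
/-- The shift along the powers of `r b`: a bijection from all representatives onto the nontrivial
ones. -/
noncomputable def sh (b : Bool) (t : W) : W := if ∃ n : ℕ, t = D.r b ^ n then t * D.r b else t

theorem sh_cases (b : Bool) (t : W) : D.sh b t = t ∨ D.sh b t = t * D.r b := by
  rw [sh]; split_ifs <;> simp

theorem sh_pow (b : Bool) (n : ℕ) : D.sh b (D.r b ^ n) = D.r b ^ (n + 1) := by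
  rw [sh, if_pos ⟨n, rfl⟩, pow_succ]

theorem sh_one (b : Bool) : D.sh b 1 = D.r b := by simpa using D.sh_pow b 0

theorem sh_injective (b : Bool) : Function.Injective (D.sh b) := by
  intro t t' h
  by_cases h1 : ∃ n : ℕ, t = D.r b ^ n <;> by_cases h2 : ∃ n : ℕ, t' = D.r b ^ n
  · rw [sh, sh, if_pos h1, if_pos h2] at h; exact mul_right_cancel h
  · obtain ⟨n, rfl⟩ := h1
    rw [sh_pow, sh, if_neg h2] at h
    exact absurd ⟨n + 1, h.symm⟩ h2
  · obtain ⟨n, rfl⟩ := h2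
    rw [sh_pow, sh, if_neg h1] at h
    exact absurd ⟨n + 1, h⟩ h1
  · rwa [sh, sh, if_neg h1, if_neg h2] at h

theorem r_pow_ne_one (b : Bool) (n : ℕ) : D.r b ^ (n + 1) ≠ 1 := by
  intro h
  have := D.pow_indep b (n + 1) (by rw [← r, h]; exact one_mem _)
  omega

theorem r_ne_one (b : Bool) : D.r b ≠ 1 := by simpa using D.r_pow_ne_one b 0

theorem sh_ne_one (b : Bool) (t : W) : D.sh b t ≠ 1 := by
  by_cases h : ∃ n : ℕ, t = D.r b ^ n
  · obtain ⟨n, rfl⟩ := h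
    rw [sh_pow]; exact D.r_pow_ne_one b n
  · rw [sh, if_neg h]
    rintro rfl
    exact h ⟨0, by simp⟩

theorem sh_ne_r {b : Bool} {t : W} (h : t ≠ 1) : D.sh b t ≠ D.r b := by
  rw [← D.sh_one b]; exact fun e => h (D.sh_injective b e)

variable {D}

theorem IsRep.sh {b : Bool} {t : W} (ht : D.IsRep b t) : D.IsRep b (D.sh b t) := by
  by_cases h : ∃ n : ℕ, t = D.r b ^ n
  · obtain ⟨n, rfl⟩ := h
    rw [sh_pow]; exact D.isRep_pow b _
  · rwa [FoldData.sh, if_neg h]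

theorem IsRep.exists_sh {b : Bool} {t : W} (ht : D.IsRep b t) (h1 : t ≠ 1) :
    ∃ s, D.IsRep b s ∧ D.sh b s = t := by
  by_cases h : ∃ n : ℕ, t = D.r b ^ n
  · obtain ⟨n, rfl⟩ := h
    cases n with
    | zero => simp at h1
    | succ n => exact ⟨_, D.isRep_pow b n, D.sh_pow b n⟩
  · exact ⟨t, ht, by rw [FoldData.sh, if_neg h]⟩

/-! ### Regrafting -/

/-- The union of the base `K`-cosets of all cosets of `G b`. -/
def base (D : FoldData W) (b : Bool) : Set W := {x | ∃ v k, D.Wd b v ∧ k ∈ D.K ∧ x = pr v * k}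

/-- The coset of `G b` with the word `v` is flagged if the last two letters of `v` are `t`, `r (!b)`
with `t ≠ r b`. Its child `r b :: v` is taken away and attached to its grandparent `v₀`. -/
def Flag (D : FoldData W) (b : Bool) (v : List W) : Prop :=
  ∃ t v₀, v = D.r (!b) :: t :: v₀ ∧ t ≠ D.r b

/-- The bijection between the cosets of `K` that are not the base of their coset of `G b` and the
bases, other than `K`, of the cosets of `G (!b)`: it tells which coset of `G (!b)` becomes a child
of which coset of `G b`, and where.

The coset of `J` at the letter `t` in the coset of `G b` with the word `v` consists of the cosets
`v t K` and `v t c K` of `K`, and `t = 1` gives the base `v K`. The coset `v t c K` gets the child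
`sh b t :: v`; the shift provides for `v c K`, and a second shift makes up for the missing child
`r b :: v = sh b 1 :: v` if `v` is flagged. For `t ≠ 1`, the coset `v t K` gets the child that was
taken away from the flagged grandchild `r (!b) :: sh b t :: v`. The condition `t ≠ r b` in `Flag`
ensures that this grandchild and the child `sh b t :: v` are themselves attached to their natural
parents, so that everything happens within bounded distance. -/
def Step (D : FoldData W) (b : Bool) (x y : W) : Prop :=
  ∃ v t k, D.Wd b v ∧ D.IsRep b t ∧ k ∈ D.K ∧
    ((t ≠ 1 ∧ x = pr v * (t * k) ∧ y = pr (D.r b :: D.r (!b) :: D.sh b t :: v) * k) ∨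
      (D.Flag b v ∧ x = pr v * (t * (D.c * k)) ∧ y = pr (D.sh b (D.sh b t) :: v) * k) ∨
      (¬ D.Flag b v ∧ x = pr v * (t * (D.c * k)) ∧ y = pr (D.sh b t :: v) * k))

theorem c_mul_notMem {k : W} (hk : k ∈ D.K) : D.c * k ∉ D.K := fun h =>
  D.c_notMem (by simpa using mul_mem h (inv_mem hk))

theorem c_mul_mem_J {k : W} (hk : k ∈ D.K) : D.c * k ∈ D.J := mul_mem D.c_mem (D.K_le hk)

theorem wd_stolen {b : Bool} {v : List W} {t : W} (hv : D.Wd b v) (ht : D.IsRep b t) :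
    D.Wd (!b) (D.r b :: D.r (!b) :: D.sh b t :: v) := by
  refine Wd.cons ?_ (D.isRep_r b) (D.r_ne_one b)
  have h := (hv.cons ht.sh (D.sh_ne_one b t)).cons (D.isRep_r (!b)) (D.r_ne_one _)
  rwa [Bool.not_not] at h

/-- `Step` at the level of words. -/
theorem Step.exists_word {b : Bool} {x y : W} (h : D.Step b x y) :
    ∃ v t j s w k, D.Wd b v ∧ D.IsRep b t ∧ j ∈ D.J ∧ (t = 1 → j ∉ D.K) ∧ x = pr v * (t * j) ∧
      D.Wd (!b) (s :: w) ∧ k ∈ D.K ∧ y = pr (s :: w) * k := by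
  obtain ⟨v, t, k, hv, ht, hk, ⟨h1, hx, hy⟩ | ⟨-, hx, hy⟩ | ⟨-, hx, hy⟩⟩ := h
  · exact ⟨v, t, k, _, _, k, hv, ht, D.K_le hk, fun h => absurd h h1, hx, wd_stolen hv ht, hk, hy⟩
  · exact ⟨v, t, _, _, _, k, hv, ht, c_mul_mem_J hk, fun _ => c_mul_notMem hk, hx,
      hv.cons ht.sh.sh (D.sh_ne_one b _), hk, hy⟩
  · exact ⟨v, t, _, _, _, k, hv, ht, c_mul_mem_J hk, fun _ => c_mul_notMem hk, hx,
      hv.cons ht.sh (D.sh_ne_one b _), hk, hy⟩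

theorem Step.mul_right {b : Bool} {x y k : W} (h : D.Step b x y) (hk : k ∈ D.K) :
    D.Step b (x * k) (y * k) := by
  obtain ⟨v, t, i, hv, ht, hi, h⟩ := h
  refine ⟨v, t, i * k, hv, ht, mul_mem hi hk, ?_⟩
  rcases h with ⟨h1, rfl, rfl⟩ | ⟨h1, rfl, rfl⟩ | ⟨h1, rfl, rfl⟩
  · exact Or.inl ⟨h1, by group, by group⟩
  · exact Or.inr (Or.inl ⟨h1, by group, by group⟩)
  · exact Or.inr (Or.inr ⟨h1, by group, by group⟩)

theorem coord_inj (hD : D.IsUniversal) {b : Bool} {v v' : List W} {t t' j j' : W}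
    (hv : D.Wd b v) (hv' : D.Wd b v') (ht : D.IsRep b t) (ht' : D.IsRep b t') (hj : j ∈ D.J)
    (hj' : j' ∈ D.J) (h : pr v * (t * j) = pr v' * (t' * j')) : v = v' ∧ t = t' ∧ j = j' := by
  obtain ⟨h1, h2⟩ := coset_inj hD hv hv' (mul_mem ht.1 (D.J_le b hj))
    (mul_mem ht'.1 (D.J_le b hj')) h
  have h3 : t = t' := by rw [← ht.rp_mul hj, h2, ht'.rp_mul hj']
  subst h3
  exact ⟨h1, rfl, mul_left_cancel h2⟩

theorem Step.notMem_base (hD : D.IsUniversal) {b : Bool} {x y : W} (h : D.Step b x y) :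
    x ∉ D.base b := by
  obtain ⟨v, t, j, s, w, k, hv, ht, hj, h1, hx, -⟩ := h.exists_word
  rintro ⟨v', k', hv', hk', hx'⟩
  rw [hx, ← one_mul k'] at hx'
  obtain ⟨-, h2, h3⟩ := coord_inj hD hv hv' ht (D.isRep_one b) hj (D.K_le hk') hx'
  exact h1 h2 (h3 ▸ hk')

theorem Step.mem_base {b : Bool} {x y : W} (h : D.Step b x y) : y ∈ D.base (!b) := by
  obtain ⟨v, t, j, s, w, k, -, -, -, -, -, hw, hk, hy⟩ := h.exists_word
  exact ⟨_, _, hw, hk, hy⟩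

theorem Step.notMem_K (hD : D.IsUniversal) {b : Bool} {x y : W} (h : D.Step b x y) :
    y ∉ D.K := by
  obtain ⟨v, t, j, s, w, k, -, -, -, -, -, hw, hk, hy⟩ := h.exists_word
  intro hyK
  have h0 : D.Wd true [] := trivial
  have := nf_inj hD hw h0 (D.K_le hk) (D.K_le hyK) (by rw [← hy, pr, one_mul])
  simp at this

theorem exists_step {b : Bool} {x : W} (hx : x ∉ D.base b) : ∃ y, D.Step b x y := by
  obtain ⟨v, h, hv, hh, rfl⟩ := D.exists_coset b x
  have hj := D.rp_inv_mul b h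
  have ht := D.isRep_rp b hh
  set t := D.rp b h
  rcases D.J_cases _ hj with hk | hk
  · refine ⟨_, v, t, t⁻¹ * h, hv, ht, hk, Or.inl ⟨?_, by group, rfl⟩⟩
    intro h1
    refine hx ⟨v, t⁻¹ * h, hv, hk, ?_⟩
    rw [h1, inv_one, one_mul]
  · have e : pr v * h = pr v * (t * (D.c * (D.c * (t⁻¹ * h)))) := by
      rw [← mul_assoc D.c, D.c_sq, one_mul, mul_inv_cancel_left]
    by_cases hf : D.Flag b v
    · exact ⟨_, v, t, _, hv, ht, hk, Or.inr (Or.inl ⟨hf, e, rfl⟩)⟩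
    · exact ⟨_, v, t, _, hv, ht, hk, Or.inr (Or.inr ⟨hf, e, rfl⟩)⟩

theorem exists_step_to {b : Bool} {y : W} (hy : y ∈ D.base (!b)) (hyK : y ∉ D.K) :
    ∃ x, D.Step b x y := by
  obtain ⟨w, k, hw, hk, rfl⟩ := hy
  have hne : w ≠ [] := by
    rintro rfl
    rw [pr, one_mul] at hyK
    exact hyK hk
  obtain ⟨s, v, rfl, hs, hs1, hv⟩ := hw.exists_cons hne
  rw [Bool.not_not] at hs hv
  obtain ⟨t, ht, rfl⟩ := hs.exists_sh hs1
  by_cases hf : D.Flag b v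
  · by_cases h1 : t = 1
    · subst h1
      rw [sh_one]
      obtain ⟨s, v₀, rfl, hs⟩ := hf
      have hs' := hv.2.1
      have hv₀ := hv.2.2
      rw [Bool.not_not] at hs' hv₀
      obtain ⟨t, ht, rfl⟩ := hs'.1.exists_sh hs'.2
      refine ⟨_, v₀, t, k, hv₀, ht, hk, Or.inl ⟨?_, rfl, rfl⟩⟩
      rintro rfl
      exact hs (D.sh_one b)
    · obtain ⟨t, ht', rfl⟩ := ht.exists_sh h1
      exact ⟨_, v, t, k, hv, ht', hk, Or.inr (Or.inl ⟨hf, rfl, rfl⟩)⟩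
  · exact ⟨_, v, t, k, hv, ht, hk, Or.inr (Or.inr ⟨hf, rfl, rfl⟩)⟩

theorem Step.right_unique (hD : D.IsUniversal) {b : Bool} {x y y' : W} (h : D.Step b x y)
    (h' : D.Step b x y') : y = y' := by
  obtain ⟨v, t, k, hv, ht, hk, h⟩ := h
  obtain ⟨v', t', k', hv', ht', hk', h'⟩ := h'
  have hc : k ≠ D.c * k' := fun e => c_mul_notMem hk' (e ▸ hk)
  have hc' : D.c * k ≠ k' := fun e => c_mul_notMem hk (e ▸ hk')
  have key := fun j j' (hj : j ∈ D.J) (hj' : j' ∈ D.J) (e : x = pr v * (t * j))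
    (e' : x = pr v' * (t' * j')) => coord_inj hD hv hv' ht ht' hj hj' (e ▸ e')
  have hJ := D.K_le hk
  have hJ' := D.K_le hk'
  have hcJ := c_mul_mem_J hk
  have hcJ' := c_mul_mem_J hk'
  rcases h with ⟨h1, hx, rfl⟩ | ⟨h1, hx, rfl⟩ | ⟨h1, hx, rfl⟩ <;>
    rcases h' with ⟨h1', hx', rfl⟩ | ⟨h1', hx', rfl⟩ | ⟨h1', hx', rfl⟩
  · obtain ⟨rfl, rfl, rfl⟩ := key _ _ hJ hJ' hx hx'; rfl
  · exact absurd (key _ _ hJ hcJ' hx hx').2.2 hc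
  · exact absurd (key _ _ hJ hcJ' hx hx').2.2 hc
  · exact absurd (key _ _ hcJ hJ' hx hx').2.2 hc'
  · obtain ⟨rfl, rfl, e⟩ := key _ _ hcJ hcJ' hx hx'
    rw [mul_left_cancel e]
  · obtain ⟨rfl, rfl, e⟩ := key _ _ hcJ hcJ' hx hx'
    exact absurd h1 h1'
  · exact absurd (key _ _ hcJ hJ' hx hx').2.2 hc'
  · obtain ⟨rfl, rfl, e⟩ := key _ _ hcJ hcJ' hx hx'
    exact absurd h1' h1
  · obtain ⟨rfl, rfl, e⟩ := key _ _ hcJ hcJ' hx hx'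
    rw [mul_left_cancel e]

theorem Step.left_unique (hD : D.IsUniversal) {b : Bool} {x x' y : W} (h : D.Step b x y)
    (h' : D.Step b x' y) : x = x' := by
  obtain ⟨v, t, k, hv, ht, hk, h⟩ := h
  obtain ⟨v', t', k', hv', ht', hk', h'⟩ := h'
  have key := fun w w' (hw : D.Wd (!b) w) (hw' : D.Wd (!b) w') (e : y = pr w * k)
    (e' : y = pr w' * k') => nf_inj hD hw hw' (D.K_le hk) (D.K_le hk') (e ▸ e')
  have hA := wd_stolen hv ht
  have hA' := wd_stolen hv' ht'
  have hB := hv.cons ht.sh.sh (D.sh_ne_one b _)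
  have hB' := hv'.cons ht'.sh.sh (D.sh_ne_one b _)
  have hC := hv.cons ht.sh (D.sh_ne_one b _)
  have hC' := hv'.cons ht'.sh (D.sh_ne_one b _)
  have inj := D.sh_injective b
  rcases h with ⟨h1, rfl, hx⟩ | ⟨h1, rfl, hx⟩ | ⟨h1, rfl, hx⟩ <;>
    rcases h' with ⟨h1', rfl, hx'⟩ | ⟨h1', rfl, hx'⟩ | ⟨h1', rfl, hx'⟩
  · obtain ⟨e, rfl⟩ := key _ _ hA hA' hx hx'
    simp only [List.cons.injEq, true_and] at e
    rw [inj e.1, e.2]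
  · obtain ⟨e, rfl⟩ := key _ _ hA hB' hx hx'
    simp only [List.cons.injEq] at e
    exact absurd e.1.symm (D.sh_ne_r (D.sh_ne_one b _))
  · obtain ⟨e, rfl⟩ := key _ _ hA hC' hx hx'
    simp only [List.cons.injEq] at e
    exact absurd ⟨_, _, e.2.symm, D.sh_ne_r h1⟩ h1'
  · obtain ⟨e, rfl⟩ := key _ _ hB hA' hx hx'
    simp only [List.cons.injEq] at e
    exact absurd e.1 (D.sh_ne_r (D.sh_ne_one b _))
  · obtain ⟨e, rfl⟩ := key _ _ hB hB' hx hx'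
    simp only [List.cons.injEq] at e
    rw [inj (inj e.1), e.2]
  · obtain ⟨e, rfl⟩ := key _ _ hB hC' hx hx'
    simp only [List.cons.injEq] at e
    exact absurd (e.2 ▸ h1) h1'
  · obtain ⟨e, rfl⟩ := key _ _ hC hA' hx hx'
    simp only [List.cons.injEq] at e
    exact absurd ⟨_, _, e.2, D.sh_ne_r h1'⟩ h1
  · obtain ⟨e, rfl⟩ := key _ _ hC hB' hx hx'
    simp only [List.cons.injEq] at e
    exact absurd (e.2 ▸ h1') h1
  · obtain ⟨e, rfl⟩ := key _ _ hC hC' hx hx'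
    simp only [List.cons.injEq] at e
    rw [inj e.1, e.2]

theorem K_subset_base {k : W} (b : Bool) (hk : k ∈ D.K) : k ∈ D.base b :=
  ⟨[], k, trivial, hk, by simp [pr]⟩

/-- The permutation of `W`, as a relation, that glues the bijections `Step true` and the inverse of
`Step false`. -/
def Fold (D : FoldData W) (x y : W) : Prop :=
  D.Step true x y ∨ D.Step false y x ∨ (x = y ∧ x ∈ D.K)

theorem existsUnique_fold (hD : D.IsUniversal) (x : W) : ∃! y, D.Fold x y := by
  have hex : ∃ y, D.Fold x y := by
    by_cases hx : x ∈ D.base true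
    · by_cases hK : x ∈ D.K
      · exact ⟨x, Or.inr (Or.inr ⟨rfl, hK⟩)⟩
      · obtain ⟨y, hy⟩ := exists_step_to (b := false) hx hK
        exact ⟨y, Or.inr (Or.inl hy)⟩
    · obtain ⟨y, hy⟩ := exists_step hx
      exact ⟨y, Or.inl hy⟩
  obtain ⟨y, hy⟩ := hex
  refine ⟨y, hy, fun y' hy' => ?_⟩
  rcases hy with h | h | ⟨rfl, h⟩ <;> rcases hy' with h' | h' | ⟨rfl, h'⟩
  · exact h'.right_unique hD h
  · exact absurd h'.mem_base (h.notMem_base hD)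
  · exact absurd (K_subset_base _ h') (h.notMem_base hD)
  · exact absurd h.mem_base (h'.notMem_base hD)
  · exact h'.left_unique hD h
  · exact absurd h' (h.notMem_K hD)
  · exact absurd (K_subset_base _ h) (h'.notMem_base hD)
  · exact absurd h (h'.notMem_K hD)
  · rfl

theorem existsUnique_fold' (hD : D.IsUniversal) (y : W) : ∃! x, D.Fold x y := by
  have hex : ∃ x, D.Fold x y := by
    by_cases hx : y ∈ D.base false
    · by_cases hK : y ∈ D.K
      · exact ⟨y, Or.inr (Or.inr ⟨rfl, hK⟩)⟩
      · obtain ⟨x, hx⟩ := exists_step_to (b := true) hx hK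
        exact ⟨x, Or.inl hx⟩
    · obtain ⟨x, hx⟩ := exists_step hx
      exact ⟨x, Or.inr (Or.inl hx)⟩
  obtain ⟨x, hx⟩ := hex
  refine ⟨x, hx, fun x' hx' => ?_⟩
  rcases hx with h | h | ⟨rfl, h⟩ <;> rcases hx' with h' | h' | ⟨rfl, h'⟩
  · exact h'.left_unique hD h
  · exact absurd h.mem_base (h'.notMem_base hD)
  · exact absurd h' (h.notMem_K hD)
  · exact absurd h'.mem_base (h.notMem_base hD)
  · exact h'.right_unique hD h
  · exact absurd (K_subset_base _ h') (h.notMem_base hD)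
  · exact absurd h (h'.notMem_K hD)
  · exact absurd (K_subset_base _ h) (h'.notMem_base hD)
  · rfl

/-- The set `W` serves as the set of edges of a new graph: the edge `z` joins the coset of `G true`
that contains `S true z` to the coset of `G false` that contains `S false z`. An edge has the
coordinates `S true z = x` and `S false z = y` if `Step true x y` or `Step false y x` holds, and `K`
is fixed. Up to the action of `K` this graph is a tree. -/
structure IsFolding (D : FoldData W) (S : Bool → Equiv.Perm W) : Prop where
  step : ∀ b x y, D.Step b x y → S (!b) ((S b).symm x) = y
  map_K : ∀ b, ∀ k ∈ D.K, S b k = k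
  map_mul_K : ∀ b x, ∀ k ∈ D.K, S b (x * k) = S b x * k

theorem exists_isFolding (hD : D.IsUniversal) :
    ∃ S : Bool → Equiv.Perm W, D.IsFolding S := by
  choose f hf hf' using existsUnique_fold hD
  choose g hg hg' using existsUnique_fold' hD
  let σ : Equiv.Perm W := ⟨f, g, fun x => (hg' _ _ (hf x)).symm, fun y => (hf' _ _ (hg y)).symm⟩
  have hσ : ∀ x y, D.Fold x y → σ x = y := fun x y h => (hf' x y h).symm
  refine ⟨fun b => if b then 1 else σ, ?_, ?_, ?_⟩
  · rintro (_ | _) x y h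
    · simp only [Bool.not_false, if_true, Equiv.Perm.one_apply, Bool.false_eq_true, if_false]
      rw [Equiv.symm_apply_eq]
      exact (hσ y x (Or.inr (Or.inl h))).symm
    · exact hσ x y (Or.inl h)
  · rintro (_ | _) k hk
    · exact hσ k k (Or.inr (Or.inr ⟨rfl, hk⟩))
    · rfl
  · rintro (_ | _) x k hk
    · refine hσ _ _ ?_
      have h : D.Fold x (σ x) := hf x
      rcases h with h | h | ⟨h, h'⟩
      · exact Or.inl (h.mul_right hk)
      · exact Or.inr (Or.inl (h.mul_right hk))
      · refine Or.inr (Or.inr ⟨?_, mul_mem h' hk⟩)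
        change x * k = σ x * k
        rw [← h]
    · rfl

end FoldData

namespace FoldData

variable {W : Type*} [Group W] {D : FoldData W} {W' : Type*} [Group W']

/-! ### The action of the amalgam over `K` -/

/-- `W'` is the amalgam over `K` of `G true` and `G false`, mapped to `W'` by the restrictions of
`η true` and `η false`. The homomorphisms are defined on all of `W`, but only their restrictions
matter. Generation is stated as an induction principle, and the universal property is stated for
permutation representations on the set `W`. -/
structure IsAmalgam (D : FoldData W) (η : Bool → W →* W') : Prop where
  agree : ∀ k ∈ D.K, η true k = η false k
  gen : ∀ P : W' → Prop, P 1 → (∀ b, ∀ g ∈ D.G b, ∀ x, P x → P (η b g * x)) → ∀ x, P x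
  univ : ∀ α : ∀ b, D.G b →* Equiv.Perm W,
    (∀ k (hk : k ∈ D.K), α true ⟨k, D.J_le _ (D.K_le hk)⟩ = α false ⟨k, D.J_le _ (D.K_le hk)⟩) →
    ∃ ρ : W' →* Equiv.Perm W, ∀ b (g : D.G b), ρ (η b g) = α b g

/-- Right multiplication by elements of `G b`, conjugated by a permutation and written as a left
action. -/
def twist (D : FoldData W) (S : Equiv.Perm W) (b : Bool) : D.G b →* Equiv.Perm W where
  toFun g := (S.trans (Equiv.mulRight (g : W)⁻¹)).trans S.symm
  map_one' := by ext; simp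
  map_mul' g h := by ext; simp [mul_assoc]

theorem IsFolding.exists_action {S : Bool → Equiv.Perm W} (hS : D.IsFolding S)
    {η : Bool → W →* W'} (hη : D.IsAmalgam η) :
    ∃ ρ : W' →* Equiv.Perm W, ∀ b, ∀ g ∈ D.G b, ∀ z, S b (ρ (η b g) z) = S b z * g⁻¹ := by
  obtain ⟨ρ, hρ⟩ := hη.univ (fun b => twist D (S b) b) (by
    intro k hk
    have h : ∀ b z, (twist D (S b) b ⟨k, D.J_le _ (D.K_le hk)⟩) z = z * k⁻¹ := fun b z => by
      change (S b).symm (S b z * k⁻¹) = _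
      rw [Equiv.symm_apply_eq, hS.map_mul_K b z _ (inv_mem hk)]
    ext1 z
    rw [h, h])
  refine ⟨ρ, fun b g hg z => ?_⟩
  have := hρ b ⟨g, hg⟩
  rw [show ρ (η b g) = _ from this]
  change S b ((S b).symm (S b z * g⁻¹)) = _
  simp

theorem IsFolding.step_of_notMem {S : Bool → Equiv.Perm W} (hS : D.IsFolding S) {b : Bool} {z : W}
    (hz : S b z ∉ D.base b) : D.Step b (S b z) (S (!b) z) := by
  obtain ⟨y, hy⟩ := exists_step hz
  have := hS.step b _ _ hy
  rw [Equiv.symm_apply_apply] at this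
  rwa [this]

theorem IsFolding.apply_of_step {S : Bool → Equiv.Perm W} (hS : D.IsFolding S) {b : Bool} {x z : W}
    (h : D.Step (!b) x (S b z)) : S (!b) z = x := by
  have := hS.step (!b) _ _ h
  rw [Bool.not_not, EmbeddingLike.apply_eq_iff_eq, Equiv.symm_apply_eq] at this
  exact this.symm

/-- Reduced products: alternating products of elements outside `K` whose first factor is not in
`G b`, and the elements of `K`. -/
inductive Red (D : FoldData W) (η : Bool → W →* W') : Bool → W' → Prop
  | base (b : Bool) {k : W} : k ∈ D.K → Red D η b (η true k)
  | cons (b : Bool) {g : W} {x : W'} : g ∈ D.G b → g ∉ D.K → Red D η b x → Red D η (!b) (η b g * x)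

theorem IsAmalgam.eta_K {η : Bool → W →* W'} (hη : D.IsAmalgam η) (b : Bool) {k : W}
    (hk : k ∈ D.K) : η b k = η true k := by
  cases b
  · exact (hη.agree k hk).symm
  · rfl

theorem Red.K_mul {η : Bool → W →* W'} (hη : D.IsAmalgam η) {b : Bool} {x : W'} {k : W}
    (h : Red D η b x) (hk : k ∈ D.K) : Red D η b (η true k * x) := by
  cases h with
  | base _ hk' => rw [← map_mul]; exact .base b (mul_mem hk hk')
  | cons b hg hgK hx =>
    rw [← hη.eta_K b hk, ← mul_assoc, ← map_mul]
    exact .cons b (mul_mem (D.J_le b (D.K_le hk)) hg)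
      (fun h => hgK (by simpa using mul_mem (inv_mem hk) h)) hx

theorem Red.mul {η : Bool → W →* W'} (hη : D.IsAmalgam η) {b : Bool} {x : W'} {g : W}
    (h : Red D η b x) (hg : g ∈ D.G b) : ∃ b', Red D η b' (η b g * x) := by
  by_cases hK : g ∈ D.K
  · rw [hη.eta_K b hK]; exact ⟨b, h.K_mul hη hK⟩
  · exact ⟨!b, .cons b hg hK h⟩

theorem IsAmalgam.exists_red {η : Bool → W →* W'} (hη : D.IsAmalgam η) (x : W') :
    ∃ b, Red D η b x := by
  refine hη.gen (fun x => ∃ b, Red D η b x) ⟨true, by simpa using Red.base true D.K.one_mem⟩ ?_ x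
  rintro b g hg x ⟨b', h⟩
  by_cases hb : b' = b
  · subst hb; exact h.mul hη hg
  cases h with
  | base b' hk =>
    rw [← hη.eta_K b hk, ← map_mul, ← mul_one (η b _)]
    refine Red.mul hη (b := b) (by simpa using Red.base b D.K.one_mem)
      (mul_mem hg (D.J_le b (D.K_le hk)))
  | cons b' hg' _ hx =>
    obtain rfl : b' = b := by cases b <;> cases b' <;> simp_all
    rw [← mul_assoc, ← map_mul]
    exact hx.mul hη (mul_mem hg hg')

theorem IsFolding.apply_one {S : Bool → Equiv.Perm W} (hS : D.IsFolding S) (b : Bool) :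
    S b 1 = 1 := hS.map_K b 1 D.K.one_mem

theorem mul_notMem_base (hD : D.IsUniversal) {b : Bool} {x g : W} (hx : x ∈ D.base b)
    (hg : g ∈ D.G b) (hK : g ∉ D.K) : x * g ∉ D.base b := by
  obtain ⟨v, k, hv, hk, rfl⟩ := hx
  rintro ⟨v', k', hv', hk', e⟩
  rw [mul_assoc] at e
  have h := (coset_inj hD hv hv' (mul_mem (D.J_le b (D.K_le hk)) hg) (D.J_le b (D.K_le hk')) e).2
  exact hK (by simpa [← h] using mul_mem (inv_mem hk) hk')

/-- Ping-pong: only the trivial element of `W'` fixes `1`. The two sets of the ping-pong game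
consist of the edges that are not the base of their coset of `G b`. -/
theorem IsFolding.eq_one_of_fix (hD : D.IsUniversal) {S : Bool → Equiv.Perm W}
    (hS : D.IsFolding S) {η : Bool → W →* W'} (hη : D.IsAmalgam η) {ρ : W' →* Equiv.Perm W}
    (hρ : ∀ b, ∀ g ∈ D.G b, ∀ z, S b (ρ (η b g) z) = S b z * g⁻¹) {x : W'} (hx : ρ x 1 = 1) :
    x = 1 := by
  have hK : ∀ k ∈ D.K, ρ (η true k) 1 = k⁻¹ := fun k hk => by
    have h := hρ true k (D.J_le _ (D.K_le hk)) 1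
    rw [hS.apply_one, one_mul] at h
    refine (S true).injective ?_
    rw [h, hS.map_K _ _ (inv_mem hk)]
  have key : ∀ b x, Red D η b x → (∃ k ∈ D.K, x = η true k) ∨ S (!b) (ρ x 1) ∉ D.base (!b) := by
    intro b x h
    induction h with
    | base b hk => exact Or.inl ⟨_, hk, rfl⟩
    | @cons b g x hg hgK _ ih =>
      right
      rw [Bool.not_not, map_mul, Equiv.Perm.mul_apply, hρ b g hg]
      refine mul_notMem_base hD ?_ (inv_mem hg) (fun h => hgK (by simpa using inv_mem h))
      rcases ih with ⟨k, hk, rfl⟩ | ih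
      · rw [hK k hk, hS.map_K _ _ (inv_mem hk)]
        exact K_subset_base _ (inv_mem hk)
      · have := (hS.step_of_notMem ih).mem_base
        rwa [Bool.not_not] at this
  obtain ⟨b, hb⟩ := hη.exists_red x
  rcases key b x hb with ⟨k, hk, rfl⟩ | h
  · rw [hK k hk, inv_eq_one] at hx
    rw [hx, map_one]
  · rw [hx, hS.apply_one] at h
    exact absurd (K_subset_base _ D.K.one_mem) h

/-- The parent of a coset has a shorter word. -/
theorem Step.length_lt {b : Bool} {x y : W} (h : D.Step b x y) (hD : D.IsUniversal) {w : List W}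
    {k : W} (hw : D.Wd (!b) w) (hk : k ∈ D.J) (hy : y = pr w * k) :
    ∃ v g, D.Wd b v ∧ g ∈ D.G b ∧ x = pr v * g ∧ v.length < w.length := by
  obtain ⟨v, t, i, hv, ht, hi, ⟨h1, hx, hy'⟩ | ⟨-, hx, hy'⟩ | ⟨-, hx, hy'⟩⟩ := h
  · obtain ⟨rfl, -⟩ := nf_inj hD hw (wd_stolen hv ht) hk (D.K_le hi) (hy ▸ hy')
    exact ⟨v, _, hv, mul_mem ht.1 (D.J_le b (D.K_le hi)), hx,
      by simp only [List.length_cons]; omega⟩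
  · obtain ⟨rfl, -⟩ := nf_inj hD hw (hv.cons ht.sh.sh (D.sh_ne_one b _)) hk (D.K_le hi) (hy ▸ hy')
    exact ⟨v, _, hv, mul_mem ht.1 (D.J_le b (c_mul_mem_J hi)), hx, by simp⟩
  · obtain ⟨rfl, -⟩ := nf_inj hD hw (hv.cons ht.sh (D.sh_ne_one b _)) hk (D.K_le hi) (hy ▸ hy')
    exact ⟨v, _, hv, mul_mem ht.1 (D.J_le b (c_mul_mem_J hi)), hx, by simp⟩

/-- Transitivity: from every coset other than the two roots, its base edge leads to a coset with a
shorter word. -/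
theorem IsFolding.exists_apply_eq (hD : D.IsUniversal) {S : Bool → Equiv.Perm W}
    (hS : D.IsFolding S) {η : Bool → W →* W'} {ρ : W' →* Equiv.Perm W}
    (hρ : ∀ b, ∀ g ∈ D.G b, ∀ z, S b (ρ (η b g) z) = S b z * g⁻¹) (z : W) :
    ∃ x, ρ x 1 = z := by
  have key : ∀ n b v h z, v.length ≤ n → D.Wd b v → h ∈ D.G b → S b z = pr v * h →
      ∃ x, ρ x 1 = z := by
    intro n
    induction n with
    | zero =>
      intro b v h z hn hv hh hz
      obtain rfl : v = [] := by simpa using hn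
      refine ⟨η b h⁻¹, (S b).injective ?_⟩
      rw [hρ b _ (inv_mem hh), hz, hS.apply_one, pr, inv_inv]
    | succ n ih =>
      intro b v h z hn hv hh hz
      by_cases hne : v = []
      · subst hne; exact ih b [] h z (by simp) hv hh hz
      suffices hs : ∃ x, ρ x 1 = (S b).symm (pr v) by
        obtain ⟨x, hx⟩ := hs
        refine ⟨η b h⁻¹ * x, (S b).injective ?_⟩
        rw [map_mul, Equiv.Perm.mul_apply, hρ b _ (inv_mem hh), hx, hz, inv_inv,
          Equiv.apply_symm_apply]
      have hbase : pr v ∈ D.base (!!b) := ⟨v, 1, by rwa [Bool.not_not], D.K.one_mem, by simp⟩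
      have hK : pr v ∉ D.K := fun hK => hne
        (nf_inj hD hv (b' := b) (w' := []) trivial (one_mem _) (D.K_le hK) (by simp [pr])).1
      obtain ⟨x, hx⟩ := exists_step_to hbase hK
      obtain ⟨v', g, hv', hg, rfl, hlt⟩ :=
        hx.length_lt hD (w := v) (k := 1) (by rwa [Bool.not_not]) (one_mem _) (by simp)
      have hx' := hS.apply_of_step (b := b) (z := (S b).symm (pr v)) (by
        rwa [Equiv.apply_symm_apply])
      exact ih (!b) v' g _ (by omega) hv' hg hx'
  obtain ⟨v, h, hv, hh, e⟩ := D.exists_coset true (S true z)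
  exact key _ true v h z le_rfl hv hh e

/-- The orbit map of the action of `W'` turns the two families of cosets in `W` into the two
families of cosets in `W'`. -/
theorem IsFolding.exists_equiv (hD : D.IsUniversal) {S : Bool → Equiv.Perm W}
    (hS : D.IsFolding S) {η : Bool → W →* W'} (hη : D.IsAmalgam η) :
    ∃ e : W' ≃ W, ∀ b, ∀ g ∈ D.G b, ∀ x, S b (e (x * η b g)) = S b (e x) * g := by
  obtain ⟨ρ, hρ⟩ := hS.exists_action hη
  have hbij : Function.Bijective fun x => ρ x⁻¹ 1 := by
    refine ⟨fun x y h => ?_, fun z => ?_⟩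
    · have h1 : ρ (x * y⁻¹) 1 = 1 := by
        simp only at h
        rw [map_mul, Equiv.Perm.mul_apply, ← h, ← Equiv.Perm.mul_apply, ← map_mul]
        simp
      exact mul_inv_eq_one.mp (hS.eq_one_of_fix hD hη hρ h1)
    · obtain ⟨x, hx⟩ := hS.exists_apply_eq hD hρ z
      exact ⟨x⁻¹, by simpa using hx⟩
  refine ⟨Equiv.ofBijective _ hbij, fun b g hg x => ?_⟩
  simp only [Equiv.ofBijective_apply]
  rw [mul_inv_rev, ← map_inv, map_mul, Equiv.Perm.mul_apply, hρ b _ (inv_mem hg), inv_inv]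

/-! ### Displacement -/

/- In this part `π` is a map to a metric space in which right multiplication by `a b` and `c` moves
points by at most `1`. The letters `r b` commute with `K`, so they can be moved past elements of
`K`. -/
section Displacement

variable {X : Type*} [PseudoMetricSpace X] {π : W → X} {b : Bool}

theorem dist_mul_r (h : ∀ x, ∀ g ∈ ({D.a b, D.c} : Set W), dist (π x) (π (x * g)) ≤ 1) (x : W) :
    dist (π x) (π (x * D.r b)) ≤ 2 := by
  have h1 := h x (D.a b) (by simp)
  have h2 := h (x * D.a b) D.c (by simp)
  have h3 := dist_triangle (π x) (π (x * D.a b)) (π (x * D.a b * D.c))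
  rw [r, ← mul_assoc]
  linarith

theorem dist_sh (h : ∀ x, ∀ g ∈ ({D.a b, D.c} : Set W), dist (π x) (π (x * g)) ≤ 1) (v t : W)
    {k : W} (hk : k ∈ D.K) : dist (π (v * t * k)) (π (v * D.sh b t * k)) ≤ 2 := by
  rcases D.sh_cases b t with e | e <;> rw [e]
  · simp
  · have := dist_mul_r h (v * t * k)
    rwa [mul_assoc _ k, D.r_comm b hk, ← mul_assoc, mul_assoc v t (D.r b)] at this

theorem dist_c (h : ∀ x, ∀ g ∈ ({D.a b, D.c} : Set W), dist (π x) (π (x * g)) ≤ 1) (v t : W)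
    {k : W} (hk : k ∈ D.K) : dist (π (v * (t * (D.c * k)))) (π (v * t * k)) ≤ 1 := by
  have := h (v * t * k) D.c (by simp)
  rwa [mul_assoc _ k, D.c_comm k hk, dist_comm, mul_assoc v] at this

end Displacement

theorem Step.dist_le {X : Type*} [PseudoMetricSpace X] {π : W → X}
    (h : ∀ b x, ∀ g ∈ ({D.a b, D.c} : Set W), dist (π x) (π (x * g)) ≤ 1) {b : Bool} {x y : W}
    (hxy : D.Step b x y) : dist (π x) (π y) ≤ 6 := by
  obtain ⟨v, t, k, -, -, hk, ⟨-, rfl, rfl⟩ | ⟨-, rfl, rfl⟩ | ⟨-, rfl, rfl⟩⟩ := hxy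
  · have h1 := dist_sh (h b) (pr v) t hk
    have h2 := dist_mul_r (h (!b)) (pr v * D.sh b t * k)
    have h3 := dist_mul_r (h b) (pr v * D.sh b t * k * D.r (!b))
    rw [mul_assoc _ k, D.r_comm _ hk, ← mul_assoc] at h2 h3
    rw [mul_assoc _ k, D.r_comm _ hk, ← mul_assoc] at h3
    have h4 := dist_triangle4 (π (pr v * t * k)) (π (pr v * D.sh b t * k))
      (π (pr v * D.sh b t * D.r (!b) * k)) (π (pr v * D.sh b t * D.r (!b) * D.r b * k))
    simp only [pr]
    rw [← mul_assoc (pr v)]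
    linarith
  · have h1 := dist_c (h b) (pr v) t hk
    have h2 := dist_sh (h b) (pr v) t hk
    have h3 := dist_sh (h b) (pr v) (D.sh b t) hk
    have h4 := dist_triangle4 (π (pr v * (t * (D.c * k)))) (π (pr v * t * k))
      (π (pr v * D.sh b t * k)) (π (pr v * D.sh b (D.sh b t) * k))
    simp only [pr]
    linarith
  · have h1 := dist_c (h b) (pr v) t hk
    have h2 := dist_sh (h b) (pr v) t hk
    have h4 := dist_triangle (π (pr v * (t * (D.c * k)))) (π (pr v * t * k))
      (π (pr v * D.sh b t * k))
    simp only [pr]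
    linarith

/-- The two coordinates of an edge are at bounded distance in `W`. -/
theorem IsFolding.dist_apply_le {S : Bool → Equiv.Perm W} (hS : D.IsFolding S)
    {X : Type*} [PseudoMetricSpace X] {π : W → X}
    (h : ∀ b x, ∀ g ∈ ({D.a b, D.c} : Set W), dist (π x) (π (x * g)) ≤ 1) (z : W) :
    dist (π (S true z)) (π (S false z)) ≤ 6 := by
  by_cases h1 : S true z ∈ D.base true
  · by_cases hK : S true z ∈ D.K
    · have h2 : z = S true z := (S true).injective (hS.map_K true _ hK).symm
      rw [← h2] at hK ⊢
      rw [hS.map_K _ _ hK]; simp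
    · obtain ⟨x, hx⟩ := exists_step_to (b := false) h1 hK
      have h3 := hS.apply_of_step (b := true) hx
      rw [dist_comm]
      rw [show S false z = x from h3]
      exact hx.dist_le h
  · exact (hS.step_of_notMem h1).dist_le h

/-- For the base of a coset that is attached to its natural parent, the two edges with this
coordinate are joined by a path in the parent. -/
theorem IsFolding.dist_le_of_natural {S : Bool → Equiv.Perm W}
    (hS : D.IsFolding S) {X : Type*} [PseudoMetricSpace X] {π : W → X}
    (h : ∀ b x, ∀ g ∈ ({D.a b, D.c} : Set W),
      dist (π ((S b).symm x)) (π ((S b).symm (x * g))) ≤ 1)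
    {b : Bool} {v : List W} {t k : W} (hv : D.Wd b v) (ht : D.IsRep b t) (ht1 : t ≠ 1)
    (hk : k ∈ D.K) (hnat : t = D.r b → ¬ D.Flag b v) :
    dist (π ((S b).symm (pr (t :: v) * k))) (π ((S (!b)).symm (pr (t :: v) * k))) ≤ 5 := by
  obtain ⟨t, ht', rfl⟩ := ht.exists_sh ht1
  have hS' : ∀ x y, D.Step b x y → (S (!b)).symm y = (S b).symm x := fun x y hxy => by
    rw [Equiv.symm_apply_eq, hS.step b x y hxy]
  by_cases hf : D.Flag b v
  · have h1 : t ≠ 1 := by rintro rfl; exact hnat (D.sh_one b) hf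
    obtain ⟨t, ht'', rfl⟩ := ht'.exists_sh h1
    rw [hS' _ _ ⟨v, t, k, hv, ht'', hk, Or.inr (Or.inl ⟨hf, rfl, rfl⟩)⟩, dist_comm]
    have h1 := dist_c (π := π ∘ (S b).symm) (h b) (pr v) t hk
    have h2 := dist_sh (π := π ∘ (S b).symm) (h b) (pr v) t hk
    have h3 := dist_sh (π := π ∘ (S b).symm) (h b) (pr v) (D.sh b t) hk
    have h4 := dist_triangle4 ((π ∘ (S b).symm) (pr v * (t * (D.c * k))))
      ((π ∘ (S b).symm) (pr v * t * k)) ((π ∘ (S b).symm) (pr v * D.sh b t * k))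
      ((π ∘ (S b).symm) (pr v * D.sh b (D.sh b t) * k))
    simp only [pr, Function.comp_apply] at *
    linarith
  · rw [hS' _ _ ⟨v, t, k, hv, ht', hk, Or.inr (Or.inr ⟨hf, rfl, rfl⟩)⟩, dist_comm]
    have h1 := dist_c (π := π ∘ (S b).symm) (h b) (pr v) t hk
    have h2 := dist_sh (π := π ∘ (S b).symm) (h b) (pr v) t hk
    have h4 := dist_triangle ((π ∘ (S b).symm) (pr v * (t * (D.c * k))))
      ((π ∘ (S b).symm) (pr v * t * k)) ((π ∘ (S b).symm) (pr v * D.sh b t * k))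
    simp only [pr, Function.comp_apply] at *
    linarith

/-- The edge whose first coordinate is the base `y` and the one whose second coordinate is `y` are
at bounded distance. -/
theorem IsFolding.dist_symm_le_of_base {S : Bool → Equiv.Perm W} (hD : D.IsUniversal)
    (hS : D.IsFolding S) {X : Type*} [PseudoMetricSpace X] {π : W → X}
    (h : ∀ b x, ∀ g ∈ ({D.a b, D.c} : Set W),
      dist (π ((S b).symm x)) (π ((S b).symm (x * g))) ≤ 1)
    {b : Bool} {y : W} (hy : y ∈ D.base (!b)) :
    dist (π ((S b).symm y)) (π ((S (!b)).symm y)) ≤ 16 := by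
  by_cases hK : y ∈ D.K
  · have h1 : ∀ b, (S b).symm y = y := fun b => by rw [Equiv.symm_apply_eq, hS.map_K b y hK]
    rw [h1, h1]; simp
  obtain ⟨x, hx⟩ := exists_step_to hy hK
  have hyx : (S (!b)).symm y = (S b).symm x := by rw [Equiv.symm_apply_eq, hS.step b x y hx]
  obtain ⟨w, k, hw, hk, rfl⟩ := hy
  have hne : w ≠ [] := by
    rintro rfl
    rw [pr, one_mul] at hK
    exact hK hk
  obtain ⟨s, v, rfl, hs, hs1, hv⟩ := hw.exists_cons hne
  rw [Bool.not_not] at hs hv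
  by_cases hnat : s = D.r b → ¬ D.Flag b v
  · have := hS.dist_le_of_natural h hv hs hs1 hk hnat
    linarith
  push Not at hnat
  -- The coset `t :: v` and the flagged coset `r (!b) :: t :: v` are attached to their natural
  -- parents; a path from the edge of `x` to that of `y` passes through both of them.
  obtain ⟨rfl, t, v, rfl, ht⟩ := hnat
  have ht' := hv.2.1
  have hv₀ := hv.2.2
  rw [Bool.not_not] at ht' hv₀
  have n1 := hS.dist_le_of_natural h hv₀ ht'.1 ht'.2 hk (fun e => absurd e ht)
  have n2 := hS.dist_le_of_natural h (hv₀.cons ht'.1 ht'.2) (D.isRep_r (!b)) (D.r_ne_one _) hk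
    (by
      rintro - ⟨s, v', e, he⟩
      simp only [Bool.not_not, List.cons.injEq] at e
      exact ht e.1)
  rw [Bool.not_not] at n2
  obtain ⟨t, hrep, rfl⟩ := ht'.1.exists_sh ht'.2
  have hxe : x = pr v * (t * k) := by
    refine hx.left_unique hD ⟨v, t, k, hv₀, hrep, hk, Or.inl ⟨?_, rfl, rfl⟩⟩
    rintro rfl
    exact ht (D.sh_one b)
  have m1 := dist_sh (π := π ∘ (S b).symm) (h b) (pr v) t hk
  have m2 := dist_mul_r (π := π ∘ (S (!b)).symm) (h (!b)) (pr v * D.sh b t * k)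
  have m3 := dist_mul_r (π := π ∘ (S b).symm) (h b) (pr v * D.sh b t * D.r (!b) * k)
  rw [mul_assoc _ k, D.r_comm _ hk, ← mul_assoc] at m2 m3
  rw [hyx, hxe]
  simp only [pr, Function.comp_apply, ← mul_assoc] at *
  set p1 := π ((S b).symm (pr v * t * k))
  set p2 := π ((S b).symm (pr v * D.sh b t * k))
  set p3 := π ((S (!b)).symm (pr v * D.sh b t * k))
  set p4 := π ((S (!b)).symm (pr v * D.sh b t * D.r (!b) * k))
  set p5 := π ((S b).symm (pr v * D.sh b t * D.r (!b) * k))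
  set p6 := π ((S b).symm (pr v * D.sh b t * D.r (!b) * D.r b * k))
  have q1 := dist_triangle4 p1 p2 p3 p4
  have q2 := dist_triangle4 p1 p4 p5 p6
  rw [dist_comm p6]
  linarith

/-- An element `x` of `W` is the `G true`-coordinate of one edge and the `G false`-coordinate of
an edge, possibly another one; these edges are at bounded distance. -/
theorem IsFolding.dist_symm_le {S : Bool → Equiv.Perm W} (hD : D.IsUniversal)
    (hS : D.IsFolding S) {X : Type*} [PseudoMetricSpace X] {π : W → X}
    (h : ∀ b x, ∀ g ∈ ({D.a b, D.c} : Set W),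
      dist (π ((S b).symm x)) (π ((S b).symm (x * g))) ≤ 1) (y : W) :
    dist (π ((S true).symm y)) (π ((S false).symm y)) ≤ 18 := by
  have key : ∀ b, ∀ y ∈ D.base b, dist (π ((S true).symm y)) (π ((S false).symm y)) ≤ 16 := by
    rintro (_ | _) y hy
    · exact hS.dist_symm_le_of_base hD h (b := true) hy
    · rw [dist_comm]; exact hS.dist_symm_le_of_base hD h (b := false) hy
  obtain ⟨⟨w, j⟩, ⟨⟨b, hw⟩, hj⟩, rfl⟩ := D.exists_isNF y
  simp only at hw hj ⊢
  -- One of `y` and `y * c` lies in the base of a coset.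
  rcases D.J_cases j hj with hk | hk
  · linarith [key b _ ⟨w, j, hw, hk, rfl⟩]
  · have h1 := key b _ ⟨w, _, hw, hk, rfl⟩
    have e : pr w * j * D.c = pr w * (D.c * j) := by
      have hj : j = D.c * (D.c * j) := by rw [← mul_assoc, D.c_sq, one_mul]
      have h2 : j * D.c = D.c * j := by
        conv_lhs => rw [hj, mul_assoc, D.c_comm _ hk, ← mul_assoc, D.c_sq, one_mul]
      rw [mul_assoc, h2]
    have h2 := h true (pr w * j) D.c (by simp)
    have h3 := h false (pr w * j) D.c (by simp)
    rw [e] at h2 h3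
    rw [dist_comm] at h3
    have := dist_triangle4 (π ((S true).symm (pr w * j))) (π ((S true).symm (pr w * (D.c * j))))
      (π ((S false).symm (pr w * (D.c * j)))) (π ((S false).symm (pr w * j)))
    linarith

end FoldData

/-! ### Right-angled Coxeter groups as amalgams -/

/-- `Γ` is covered by two full subgraphs `S true`, `S false` without edges between the rest of one
and the rest of the other, meeting in `L ∪ {c}`; the vertices `c` and `a b ∈ S b` are joined to all
of `L`, but `c` is not joined to `a b`. -/
structure IsFoldGraph {V : Type*} (Γ : SimpleGraph V) (S : Bool → Set V) (L : Set V)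
    (a : Bool → V) (c : V) : Prop where
  inter : ∀ v, v ∈ S true → v ∈ S false → v = c ∨ v ∈ L
  subset : ∀ b, insert c L ⊆ S b
  cover : ∀ v, ∃ b, v ∈ S b
  edge : ∀ u v, Γ.Adj u v → ∃ b, u ∈ S b ∧ v ∈ S b
  a_mem : ∀ b, a b ∈ S b
  a_ne : ∀ b, a b ≠ c
  not_adj : ∀ b, ¬ Γ.Adj (a b) c
  adj_a : ∀ b, ∀ x ∈ L, Γ.Adj x (a b)
  adj_c : ∀ x ∈ L, Γ.Adj x c

/-- `Δ` is obtained by gluing the full subgraphs `S true` and `S false` of `Γ`, embedded by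
`κ true` and `κ false`, along `L`. -/
structure IsGluing {V V' : Type*} (Γ : SimpleGraph V) (S : Bool → Set V) (L : Set V)
    (Δ : SimpleGraph V') (κ : Bool → V → V') : Prop where
  subset : ∀ b, L ⊆ S b
  injOn : ∀ b, InjOn (κ b) (S b)
  adj : ∀ b, ∀ x ∈ S b, ∀ y ∈ S b, Δ.Adj (κ b x) (κ b y) ↔ Γ.Adj x y
  cover : ∀ u, ∃ b, ∃ x ∈ S b, κ b x = u
  edge : ∀ u v, Δ.Adj u v → ∃ b, ∃ x ∈ S b, ∃ y ∈ S b, κ b x = u ∧ κ b y = v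
  overlap : ∀ x ∈ S true, ∀ y ∈ S false, κ true x = κ false y → x = y ∧ x ∈ L
  agree : ∀ x ∈ L, κ true x = κ false x

namespace RACG

section

variable {V V' : Type*} {Γ : SimpleGraph V} {Δ : SimpleGraph V'} {S : Bool → Set V} {L : Set V}
  {a : Bool → V} {c : V} {κ : Bool → V → V'}

theorem eq_on_special {T : Set V} {H : Type*} [Group H] {φ : RACG Γ →* H}
    {α : special Γ T →* H} (h : ∀ x (hx : x ∈ T), φ (gen Γ x) = α ⟨gen Γ x, gen_mem_special hx⟩)
    (g : special Γ T) : φ g = α g := by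
  obtain ⟨g, hg⟩ := g
  change φ g = _
  induction hg using Subgroup.closure_induction with
  | mem y hy => obtain ⟨v, hv, rfl⟩ := hy; exact h v hv
  | one => rw [map_one]; exact (map_one α).symm
  | mul y z hy hz h1 h2 => rw [map_mul, h1, h2, ← map_mul]; rfl
  | inv y hy h => rw [map_inv, h, ← map_inv]; rfl

theorem commute_of_mem_special {T : Set V} {v : V} (h : ∀ x ∈ T, Γ.Adj x v) {k : RACG Γ}
    (hk : k ∈ special Γ T) : k * gen Γ v = gen Γ v * k := by
  have h1 : special Γ T ≤ Subgroup.centralizer {gen Γ v} := by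
    rw [special, Subgroup.closure_le]
    rintro _ ⟨x, hx, rfl⟩
    simp only [SetLike.mem_coe, Subgroup.mem_centralizer_singleton_iff]
    exact gen_comm (h x hx)
  exact Subgroup.mem_centralizer_singleton_iff.mp (h1 hk)

theorem mem_special_insert (h : ∀ x ∈ L, Γ.Adj x c) {j : RACG Γ}
    (hj : j ∈ special Γ (insert c L)) : j ∈ special Γ L ∨ gen Γ c * j ∈ special Γ L := by
  have hc := fun k => commute_of_mem_special (Γ := Γ) h (k := k)
  have hcc := gen_mul_self (Γ := Γ) c
  induction hj using Subgroup.closure_induction with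
  | mem y hy =>
    obtain ⟨v, rfl | hv, rfl⟩ := hy
    · right; rw [hcc]; exact one_mem _
    · exact Or.inl (gen_mem_special hv)
  | one => exact Or.inl (one_mem _)
  | mul y z _ _ h1 h2 =>
    rcases h1 with h1 | h1 <;> rcases h2 with h2 | h2
    · exact Or.inl (mul_mem h1 h2)
    · right
      rw [← mul_assoc, ← hc y h1, mul_assoc]
      exact mul_mem h1 h2
    · right
      rw [← mul_assoc]
      exact mul_mem h1 h2
    · left
      have := mul_mem h1 h2
      rwa [← mul_assoc, hc _ h1, ← mul_assoc, hcc, one_mul] at this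
  | inv y _ h =>
    rcases h with h | h
    · exact Or.inl (inv_mem h)
    · right
      have h1 := inv_mem h
      have h2 := hc _ h1
      rw [mul_inv_rev, gen_inv, mul_assoc, hcc, mul_one] at h2
      rw [mul_inv_rev, gen_inv] at h1
      rw [h2, ← mul_assoc, ← mul_assoc, hcc, one_mul] at *
      exact h1

open Classical in
/-- The vertices `a`, `c` generate an infinite dihedral group: they act on `ℤ` by the reflections
`x ↦ -x` and `x ↦ 1 - x`. -/
theorem exists_dihedral {a c : V} (hac : a ≠ c) (hadj : ¬ Γ.Adj a c) :
    ∃ φ : RACG Γ →* Equiv.Perm ℤ, (∀ x, φ (gen Γ a) x = -x) ∧ (∀ x, φ (gen Γ c) x = 1 - x) ∧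
      ∀ v, v ≠ a → v ≠ c → φ (gen Γ v) = 1 := by
  obtain ⟨φ, hφ⟩ := exists_hom (Γ := Γ) (H := Equiv.Perm ℤ)
    (fun v => if v = a then Equiv.neg ℤ else if v = c then Equiv.subLeft 1 else 1)
    (by intro v; ext x; split_ifs <;> simp)
    (by
      intro v w h
      by_cases h1 : v = a
      · subst h1
        have h2 : w ≠ c := by rintro rfl; exact hadj h
        simp [h.ne', h2]
      · by_cases h2 : v = c
        · subst h2
          have h3 : w ≠ a := by rintro rfl; exact hadj h.symm
          simp [h.ne', h3]
        · simp [h1, h2])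
  refine ⟨φ, fun x => ?_, fun x => ?_, fun v h1 h2 => ?_⟩
  · simp [hφ]
  · simp [hφ, hac.symm]
  · simp [hφ, h1, h2]

theorem pow_mem_special_insert (hL : ∀ x ∈ L, Γ.Adj x c) {a : V} (haL : a ∉ L) (hac : a ≠ c)
    (hadj : ¬ Γ.Adj a c) (n : ℕ) (h : (gen Γ a * gen Γ c) ^ n ∈ special Γ (insert c L)) :
    n = 0 := by
  obtain ⟨φ, h1, h2, h3⟩ := exists_dihedral hac hadj
  have hker : special Γ L ≤ φ.ker := by
    rw [special, Subgroup.closure_le]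
    rintro _ ⟨x, hx, rfl⟩
    exact h3 x (by rintro rfl; exact haL hx) (hL x hx).ne
  have hpow : ∀ n : ℕ, φ ((gen Γ a * gen Γ c) ^ n) 0 = -n := by
    intro n
    induction n with
    | zero => simp
    | succ n ih =>
      rw [pow_succ', map_mul, Equiv.Perm.mul_apply, ih, map_mul, Equiv.Perm.mul_apply, h2, h1]
      push_cast; ring
  rcases mem_special_insert hL h with h | h
  · have h4 := hpow n
    rw [MonoidHom.mem_ker.mp (hker h), Equiv.Perm.one_apply] at h4
    omega
  · have h4 := congrArg (fun σ : Equiv.Perm ℤ => σ 0) (MonoidHom.mem_ker.mp (hker h))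
    simp only [map_mul, Equiv.Perm.mul_apply, hpow, h2, Equiv.Perm.one_apply] at h4
    omega

/-- The special subgroups attached to a graph covered by two subgraphs. -/
noncomputable def foldData (h : IsFoldGraph Γ S L a c) : FoldData (RACG Γ) where
  G b := special Γ (S b)
  J := special Γ (insert c L)
  K := special Γ L
  a b := gen Γ (a b)
  c := gen Γ c
  J_le b := special_mono (h.subset b)
  K_le := special_mono (subset_insert c L)
  inter b x h1 h2 := by
    refine special_mono ?_ (mem_special_inter h1 h2)
    rintro v ⟨hv, hv'⟩
    cases b
    · exact h.inter v hv' hv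
    · exact h.inter v hv hv'
  gen P h1 hP x := by
    refine (coxeterSystem Γ).simple_induction_right x h1 fun x v hx => ?_
    obtain ⟨b, hb⟩ := h.cover v
    exact hP b _ (gen_mem_special hb) x hx
  a_mem b := gen_mem_special (h.a_mem b)
  c_mem := gen_mem_special (mem_insert c L)
  c_notMem hc := (h.adj_c c (gen_mem_special_iff.mp hc)).ne rfl
  c_sq := gen_mul_self c
  J_cases _ hj := mem_special_insert h.adj_c hj
  a_comm b _ hk := commute_of_mem_special (h.adj_a b) hk
  c_comm _ hk := commute_of_mem_special h.adj_c hk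
  pow_indep b n := pow_mem_special_insert h.adj_c
    (fun hL => (h.adj_a b _ hL).ne rfl) (h.a_ne b) (h.not_adj b) n

/-- The universal property of the right-angled Coxeter group of a graph that is glued from two
subgraphs. -/
theorem exists_hom_of_gluing (h : IsGluing Γ S L Δ κ) {H : Type*} [Group H]
    (α : ∀ b, special Γ (S b) →* H)
    (hα : ∀ x (hx : x ∈ L), α true ⟨gen Γ x, gen_mem_special (h.subset _ hx)⟩ =
      α false ⟨gen Γ x, gen_mem_special (h.subset _ hx)⟩) :
    ∃ ρ : RACG Δ →* H, ∀ b x (hx : x ∈ S b),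
      ρ (gen Δ (κ b x)) = α b ⟨gen Γ x, gen_mem_special hx⟩ := by
  choose β ξ hξ hκ using h.cover
  have key' : ∀ b b' x y (hx : x ∈ S b) (hy : y ∈ S b'), κ b' y = κ b x →
      α b' ⟨gen Γ y, gen_mem_special hy⟩ = α b ⟨gen Γ x, gen_mem_special hx⟩ := by
    intro b b' x y hx hy e
    by_cases hb : b' = b
    · subst hb
      obtain rfl := h.injOn _ hy hx e
      rfl
    · cases b <;> cases b' <;> simp only [not_true_eq_false, reduceCtorEq, not_false_eq_true] at hb
      · obtain ⟨rfl, hL⟩ := h.overlap _ hy _ hx e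
        exact hα _ hL
      · obtain ⟨rfl, hL⟩ := h.overlap _ hx _ hy e.symm
        exact (hα _ hL).symm
  have key := fun b x (hx : x ∈ S b) => key' b _ x _ hx (hξ (κ b x)) (hκ (κ b x))
  obtain ⟨ρ, hρ⟩ := exists_hom (Γ := Δ)
    (fun u => α (β u) ⟨gen Γ (ξ u), gen_mem_special (hξ u)⟩)
    (fun u => by
      rw [← map_mul]
      convert map_one (α (β u))
      exact Subtype.ext (gen_mul_self _))
    (fun u v huv => by
      obtain ⟨b, x, hx, y, hy, rfl, rfl⟩ := h.edge u v huv
      rw [key b x hx, key b y hy, ← map_mul, ← map_mul]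
      congr 1
      exact Subtype.ext (gen_comm ((h.adj b x hx y hy).mp huv)))
  exact ⟨ρ, fun b x hx => by rw [hρ, key b x hx]⟩

/-- `Γ` itself is glued from its two pieces along their intersection. -/
theorem isGluing_self (h : IsFoldGraph Γ S L a c) :
    IsGluing Γ S (insert c L) Γ (fun _ => id) where
  subset := h.subset
  injOn _ := Function.injective_id.injOn
  adj _ _ _ _ _ := Iff.rfl
  cover u := let ⟨b, hb⟩ := h.cover u; ⟨b, u, hb, rfl⟩
  edge u v huv := let ⟨b, hu, hv⟩ := h.edge u v huv; ⟨b, u, hu, v, hv, rfl, rfl⟩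
  overlap x hx y hy hxy := by
    obtain rfl : x = y := hxy
    exact ⟨rfl, h.inter x hx hy⟩
  agree _ _ := rfl

theorem isUniversal_foldData (h : IsFoldGraph Γ S L a c) : (foldData h).IsUniversal := by
  intro Ω α hα
  obtain ⟨ρ, hρ⟩ := exists_hom_of_gluing (isGluing_self h) α
    (fun x hx => hα _ (gen_mem_special hx))
  exact ⟨ρ, fun b g => eq_on_special (hρ b) g⟩

open Classical in
/-- The homomorphisms that map the special subgroups of the pieces to the glued group, extended by
killing the other vertices. -/
theorem exists_eta (h : IsGluing Γ S L Δ κ) :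
    ∃ η : Bool → RACG Γ →* RACG Δ, ∀ b, ∀ x ∈ S b, η b (gen Γ x) = gen Δ (κ b x) := by
  have : ∀ b, ∃ η : RACG Γ →* RACG Δ, ∀ x ∈ S b, η (gen Γ x) = gen Δ (κ b x) := by
    intro b
    obtain ⟨η, hη⟩ := exists_hom (Γ := Γ) (fun v => if v ∈ S b then gen Δ (κ b v) else 1)
      (fun v => by split_ifs <;> simp [gen_mul_self])
      (fun v w hvw => by
        split_ifs with h1 h2
        · exact gen_comm ((h.adj b v h1 w h2).mpr hvw)
        all_goals simp)
    exact ⟨η, fun x hx => by rw [hη, if_pos hx]⟩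
  choose η hη using this
  exact ⟨η, hη⟩

theorem isAmalgam_foldData (h : IsFoldGraph Γ S L a c) (h' : IsGluing Γ S L Δ κ)
    {η : Bool → RACG Γ →* RACG Δ} (hη : ∀ b, ∀ x ∈ S b, η b (gen Γ x) = gen Δ (κ b x)) :
    (foldData h).IsAmalgam η where
  agree k hk := by
    refine eq_on_special (α := (η false).comp (special Γ L).subtype) (fun x hx => ?_) ⟨k, hk⟩
    rw [hη true x (h'.subset _ hx), h'.agree x hx, ← hη false x (h'.subset _ hx)]
    rfl
  gen P h1 hP x := by
    refine (coxeterSystem Δ).simple_induction_left x h1 fun x u hx => ?_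
    obtain ⟨b, v, hv, rfl⟩ := h'.cover u
    have := hP b _ (gen_mem_special hv) x hx
    rwa [hη b v hv] at this
  univ α hα := by
    obtain ⟨ρ, hρ⟩ := exists_hom_of_gluing h' α (fun x hx => hα _ (gen_mem_special hx))
    refine ⟨ρ, fun b g => eq_on_special (φ := ρ.comp (η b)) (fun x hx => ?_) g⟩
    rw [← hρ b x hx, ← hη b x hx]
    rfl

/-- The two matchings of cosets: bijections `p true` and `p false` that are equivariant for the two
subgroups, and whose values, and preimages, are at bounded distance. -/
theorem exists_matching (h : IsFoldGraph Γ S L a c) (h' : IsGluing Γ S L Δ κ) :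
    ∃ p : Bool → (RACG Γ ≃ RACG Δ),
      (∀ b x, ∀ s ∈ S b, p b (x * gen Γ s) = p b x * gen Δ (κ b s)) ∧
      (∀ x, dist (p true x) (p false x) ≤ 18) ∧
      ∀ y, dist ((p true).symm y) ((p false).symm y) ≤ 6 := by
  have hD := isUniversal_foldData h
  obtain ⟨η, hη⟩ := exists_eta h'
  have hA := isAmalgam_foldData h h' hη
  obtain ⟨T, hT⟩ := FoldData.exists_isFolding hD
  obtain ⟨e, he⟩ := hT.exists_equiv hD hA
  have hp : ∀ b x, ∀ s ∈ S b,
      e.symm ((T b).symm (x * gen Γ s)) = e.symm ((T b).symm x) * gen Δ (κ b s) := by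
    intro b x s hs
    rw [Equiv.symm_apply_eq, Equiv.symm_apply_eq, ← hη b s hs, he b _ (gen_mem_special hs)]
    simp
  refine ⟨fun b => (T b).symm.trans e.symm, hp, fun x => ?_, fun y => ?_⟩
  · refine hT.dist_symm_le hD (π := e.symm) ?_ x
    rintro b x g (rfl | rfl)
    · exact (hp b x _ (h.a_mem b)).symm ▸ (dist_mul_gen _ _).le
    · exact (hp b x _ (h.subset b (mem_insert c L))).symm ▸ (dist_mul_gen _ _).le
  · refine hT.dist_apply_le (π := id) ?_ (e y)
    rintro b x g (rfl | rfl)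
    · exact (dist_mul_gen _ _).le
    · exact (dist_mul_gen _ _).le

end

/-! ### Copies of subcomplexes -/

section

variable {V V' : Type*} {Γ : SimpleGraph V} {Δ : SimpleGraph V'}

theorem inv_mul_map_mem_special {f : RACG Γ → RACG Δ} {T : Set V} {T' : Set V'}
    (hf : ∀ x, ∀ v ∈ T, (f x)⁻¹ * f (x * gen Γ v) ∈ special Δ T') {t : RACG Γ}
    (ht : t ∈ special Γ T) (g : RACG Γ) : (f g)⁻¹ * f (g * t) ∈ special Δ T' := by
  induction ht using Subgroup.closure_induction generalizing g with
  | mem y hy => obtain ⟨v, hv, rfl⟩ := hy; exact hf g v hv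
  | one => simp
  | mul y z _ _ h1 h2 =>
    have := mul_mem (h1 g) (h2 (g * y))
    rwa [mul_assoc, mul_inv_cancel_left, mul_assoc] at this
  | inv y _ h =>
    have := inv_mem (h (g * y⁻¹))
    rwa [inv_mul_cancel_right, mul_inv_rev, inv_inv] at this

theorem mem_copy_self {T : Set V} (g : RACG Γ) : g ∈ copy Γ T g := by simp [copy]

theorem image_copy {p : RACG Γ ≃ RACG Δ} {κ : V → V'} {T : Set V}
    (hp : ∀ x, ∀ s ∈ T, p (x * gen Γ s) = p x * gen Δ (κ s)) (g : RACG Γ) :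
    p '' copy Γ T g = copy Δ (κ '' T) (p g) := by
  apply Subset.antisymm
  · rintro _ ⟨x, hx, rfl⟩
    have := inv_mul_map_mem_special (f := p) (T' := κ '' T) (fun x v hv => by
      rw [hp x v hv, inv_mul_cancel_left]
      exact gen_mem_special ⟨v, hv, rfl⟩) hx g
    rwa [mul_inv_cancel_left] at this
  · intro y hy
    have := inv_mul_map_mem_special (f := p.symm) (T' := T) (fun y u hu => by
      obtain ⟨v, hv, rfl⟩ := hu
      have h1 : p.symm (y * gen Δ (κ v)) = p.symm y * gen Γ v := by
        rw [Equiv.symm_apply_eq, hp _ v hv, Equiv.apply_symm_apply]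
      rw [h1, inv_mul_cancel_left]
      exact gen_mem_special hv) hy (p g)
    rw [mul_inv_cancel_left, Equiv.symm_apply_apply] at this
    exact ⟨p.symm y, this, p.apply_symm_apply y⟩

theorem subset_of_copy_subset {T S : Set V} {h g : RACG Γ} (hs : copy Γ T h ⊆ copy Γ S g) :
    T ⊆ S := by
  intro v hv
  have h1 : g⁻¹ * h ∈ special Γ S := hs (mem_copy_self h)
  have h2 : g⁻¹ * (h * gen Γ v) ∈ special Γ S := hs (by
    change h⁻¹ * (h * gen Γ v) ∈ special Γ T
    rw [inv_mul_cancel_left]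
    exact gen_mem_special hv)
  have h3 := mul_mem (inv_mem h1) h2
  rw [← mul_assoc g⁻¹, inv_mul_cancel_left] at h3
  exact gen_mem_special_iff.mp h3

/-- A bijection that is equivariant for the generators in `S` restricts to colored cubical
isomorphisms between copies. -/
theorem exists_isColoredCubicalIso {p : RACG Γ ≃ RACG Δ} {κ : V → V'} {S : Set V}
    (hp : ∀ x, ∀ s ∈ S, p (x * gen Γ s) = p x * gen Δ (κ s)) (hκ : InjOn κ S)
    (hadj : ∀ x ∈ S, ∀ y ∈ S, Δ.Adj (κ x) (κ y) ↔ Γ.Adj x y) (g : RACG Γ) :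
    ∃ φ : copy Γ S g ≃ copy Δ (κ '' S) (p g), IsColoredCubicalIso κ φ ∧
      ∀ x, (φ x : RACG Δ) = p x := by
  refine ⟨(p.image _).trans (Equiv.setCongr (image_copy hp g)), ⟨fun Q => ?_, ?_⟩, fun x => rfl⟩
  · have himage : Subtype.val '' (((p.image _).trans (Equiv.setCongr (image_copy hp g))) '' Q) =
        p '' (Subtype.val '' Q) := by
      rw [image_image, image_image]; rfl
    have hQ : Subtype.val '' Q ⊆ copy Γ S g := Subtype.coe_image_subset _ _
    have hcopy : ∀ T ⊆ S, ∀ h, p '' copy Γ T h = copy Δ (κ '' T) (p h) := fun T hT h =>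
      image_copy (fun x s hs => hp x s (hT hs)) h
    rw [himage]
    generalize Subtype.val '' Q = Q at hQ
    constructor
    · rintro ⟨h, T, hT, rfl⟩
      have hTS := subset_of_copy_subset hQ
      refine ⟨p h, κ '' T, ?_, hcopy T hTS h⟩
      rintro _ ⟨x, hx, rfl⟩ _ ⟨y, hy, rfl⟩ hne
      exact (hadj x (hTS hx) y (hTS hy)).mpr (hT hx hy (by rintro rfl; exact hne rfl))
    · rintro ⟨h', T', hT', e⟩
      have hT'S : T' ⊆ κ '' S := by
        refine subset_of_copy_subset (h := h') (g := p g) ?_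
        rw [← e, ← image_copy hp g]
        exact image_mono hQ
      obtain ⟨T, hTS, rfl⟩ := subset_image_iff.mp hT'S
      obtain ⟨h, rfl⟩ := p.surjective h'
      rw [← hcopy T hTS] at e
      refine ⟨h, T, fun x hx y hy hne => ?_, p.injective.image_injective e⟩
      exact (hadj x (hTS hx) y (hTS hy)).mp (hT' ⟨x, hx, rfl⟩ ⟨y, hy, rfl⟩
        (fun e => hne (hκ (hTS hx) (hTS hy) e)))
  · intro x y s hs
    change _ ↔ p y = p x * gen Δ (κ s)
    rw [← hp x s hs, p.apply_eq_iff_eq]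

theorem coarselyPreservesCopies {f p : RACG Γ ≃ RACG Δ} {κ : V → V'} {S : Set V}
    (hp : ∀ x, ∀ s ∈ S, p (x * gen Γ s) = p x * gen Δ (κ s)) (hκ : InjOn κ S)
    (hadj : ∀ x ∈ S, ∀ y ∈ S, Δ.Adj (κ x) (κ y) ↔ Γ.Adj x y) {R : ℝ} (hR : 0 ≤ R)
    (hf : ∀ x, dist (f x) (p x) ≤ R) : CoarselyPreservesCopies Γ Δ S κ f := by
  have hH : ∀ g, Metric.hausdorffEDist (f '' copy Γ S g) (copy Δ (κ '' S) (p g)) ≤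
      ENNReal.ofReal R := by
    intro g
    have he : ∀ x, edist (f x) (p x) ≤ ENNReal.ofReal R := fun x => by
      rw [edist_dist]; exact ENNReal.ofReal_le_ofReal (hf x)
    rw [← image_copy hp]
    apply Metric.hausdorffEDist_le_of_mem_edist
    · rintro _ ⟨x, hx, rfl⟩
      exact ⟨p x, ⟨x, hx, rfl⟩, he x⟩
    · rintro _ ⟨x, hx, rfl⟩
      exact ⟨f x, ⟨x, hx, rfl⟩, by rw [edist_comm]; exact he x⟩
  refine ⟨R, hR, fun g => ⟨p g, hH g, ?_⟩, fun g' => ⟨p.symm g', ?_⟩⟩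
  · obtain ⟨φ, h1, h2⟩ := exists_isColoredCubicalIso hp hκ hadj g
    exact ⟨φ, h1, fun x => by rw [h2]; exact hf x⟩
  · have := hH (p.symm g')
    rwa [p.apply_symm_apply] at this

/-- A bijection such that it and its inverse move neighbours by a bounded amount is a
quasiisometry. -/
theorem isQuasiIsometry_of_gen {f : RACG Γ ≃ RACG Δ} {L : ℝ} (hL : 1 ≤ L)
    (h1 : ∀ x v, dist (f x) (f (x * gen Γ v)) ≤ L)
    (h2 : ∀ y u, dist (f.symm y) (f.symm (y * gen Δ u)) ≤ L) : IsQuasiIsometry f := by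
  refine ⟨L, 0, hL, le_rfl, fun x x' => ⟨?_, ?_⟩, fun y => ⟨f.symm y, by simp⟩⟩
  · have := dist_le_mul_of_gen h2 (f x) (f x')
    rw [f.symm_apply_apply, f.symm_apply_apply] at this
    rw [sub_zero, inv_mul_le_iff₀ (by linarith)]
    exact this
  · rw [add_zero]; exact dist_le_mul_of_gen h1 x x'

/-- The bijection `p true` is the quasiisometry. It is exactly equivariant on the cosets of the
first special subgroup, and close to `p false`, which is exactly equivariant on those of the
second. -/
theorem exists_quasiIsometry {S : Bool → Set V} {L : Set V} {a : Bool → V} {c : V}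
    {κ : Bool → V → V'} (h : IsFoldGraph Γ S L a c) (h' : IsGluing Γ S L Δ κ) :
    ∃ f : RACG Γ → RACG Δ, IsQuasiIsometry f ∧
      ∀ b, ∀ T ⊆ S b, CoarselyPreservesCopies Γ Δ T (κ b) f := by
  obtain ⟨p, hp, hd, hd'⟩ := exists_matching h h'
  -- A generator of the second piece moves `p true` by at most `18 + 1 + 18`.
  refine ⟨p true, isQuasiIsometry_of_gen (L := 37) (by norm_num) (fun x v => ?_) (fun y u => ?_),
    fun b T hT => ?_⟩
  · have key : ∀ b, dist (p true x) (p b x) ≤ 18 := by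
      rintro (_ | _)
      · exact hd x
      · simp
    have key' : ∀ b, dist (p true (x * gen Γ v)) (p b (x * gen Γ v)) ≤ 18 := by
      rintro (_ | _)
      · exact hd _
      · simp
    obtain ⟨b, hb⟩ := h.cover v
    have h1 := dist_triangle4 (p true x) (p b x) (p b (x * gen Γ v)) (p true (x * gen Γ v))
    have h2 := key b
    have h3 := key' b
    have h4 := dist_mul_gen (p b x) (κ b v)
    rw [← hp b x v hb] at h4
    rw [dist_comm] at h3
    linarith
  · have key : ∀ b y, dist ((p true).symm y) ((p b).symm y) ≤ 6 := by
      rintro (_ | _) y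
      · exact hd' y
      · simp
    obtain ⟨b, v, hv, rfl⟩ := h'.cover u
    have h0 : (p b).symm (y * gen Δ (κ b v)) = (p b).symm y * gen Γ v := by
      rw [Equiv.symm_apply_eq, hp b _ v hv, Equiv.apply_symm_apply]
    have h1 := dist_triangle4 ((p true).symm y) ((p b).symm y) ((p b).symm (y * gen Δ (κ b v)))
      ((p true).symm (y * gen Δ (κ b v)))
    have h2 := key b y
    have h3 := key b (y * gen Δ (κ b v))
    have h4 := dist_mul_gen ((p b).symm y) v
    rw [← h0] at h4
    rw [dist_comm] at h3
    linarith
  · refine coarselyPreservesCopies (R := 18) (fun x s hs => hp b x s (hT hs))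
      ((h'.injOn b).mono hT) (fun x hx y hy => h'.adj b x (hT hx) y (hT hy)) (by norm_num) ?_
    intro x
    cases b
    · exact hd x
    · simp

end

end RACG

/-! ### The unfolded graph -/

theorem IsUnionOfComponents.subset {V : Type*} {Γ : SimpleGraph V} {U G : Set V}
    (h : IsUnionOfComponents Γ U G) : G ⊆ U := by
  obtain ⟨𝒞, rfl⟩ := h
  intro x hx
  simp only [mem_iUnion] at hx
  obtain ⟨K, -, y, -, rfl⟩ := hx
  exact y.2

theorem IsUnionOfComponents.mem_of_adj {V : Type*} {Γ : SimpleGraph V} {U G : Set V}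
    (h : IsUnionOfComponents Γ U G) {x y : V} (hx : x ∈ G) (hy : y ∈ U) (hxy : Γ.Adj x y) :
    y ∈ G := by
  obtain ⟨𝒞, rfl⟩ := h
  simp only [mem_iUnion] at hx ⊢
  obtain ⟨K, hK, z, hz, rfl⟩ := hx
  refine ⟨K, hK, ⟨y, hy⟩, ?_, rfl⟩
  have h1 : (Γ.induce U).Adj ⟨y, hy⟩ z := hxy.symm
  rw [SimpleGraph.ConnectedComponent.mem_supp_iff] at hz ⊢
  rw [← hz]
  exact SimpleGraph.ConnectedComponent.sound h1.reachable

/-- `x` has a neighbour in `G`. -/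
def Meets {V : Type*} (Γ : SimpleGraph V) (G : Set V) (x : V) : Prop := ∃ g ∈ G, Γ.Adj x g

theorem mem_joinHull {V : Type*} {Γ : SimpleGraph V} {E F G : Set V} {x : V} :
    x ∈ joinHull Γ E F G ↔ x ∈ F ∨ x ∈ G ∨ x ∈ E ∧ Meets Γ G x := by
  simp only [joinHull, mem_union, mem_ofPred_eq, or_assoc, Meets]

theorem SimpleGraph.CliqueFree.not_adj_of_adj {V : Type*} {Γ : SimpleGraph V}
    (h : Γ.CliqueFree 3) {x y z : V} (hxz : Γ.Adj x z) (hyz : Γ.Adj y z) : ¬ Γ.Adj x y := by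
  classical
  exact fun hxy => h {x, y, z} (SimpleGraph.is3Clique_triple_iff.mpr ⟨hxy, hxz, hyz⟩)

/-- The part of the situation that is used: `Γ` is covered by `E`, `F`, `G` and `H`, where `E` is
independent and joined to `F`, there are no edges between `G` and `H`, and `c` is the only vertex
of `E` with neighbours in both `G` and `H`. -/
structure IsUnfolding {V : Type*} (Γ : SimpleGraph V) (E F G H : Set V) (a b c : V) : Prop where
  cover : ∀ v, v ∈ E ∨ v ∈ F ∨ v ∈ G ∨ v ∈ H
  disjEF : ∀ v ∈ E, v ∉ F
  disjEG : ∀ v ∈ E, v ∉ G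
  disjEH : ∀ v ∈ E, v ∉ H
  disjGH : ∀ v ∈ G, v ∉ H
  join : ∀ e ∈ E, ∀ f ∈ F, Γ.Adj e f
  indep : ∀ x ∈ E, ∀ y ∈ E, ¬ Γ.Adj x y
  separated : ∀ x ∈ G, ∀ y ∈ H, ¬ Γ.Adj x y
  aE : a ∈ E
  bE : b ∈ E
  cE : c ∈ E
  aG : Meets Γ G a
  cG : Meets Γ G c
  cH : Meets Γ H c
  aH : ¬ Meets Γ H a
  bG : ¬ Meets Γ G b
  unique : ∀ x ∈ E, Meets Γ G x → Meets Γ H x → x = c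

namespace IsUnfolding

variable {V : Type*} {Γ : SimpleGraph V} {E F G H : Set V} {a b c : V}

/-- The two pieces: the second one contains all vertices of `E` without neighbours in `G`, also
those without neighbours in `H`. -/
def piece (Γ : SimpleGraph V) (E F G H : Set V) (b : Bool) : Set V :=
  if b then joinHull Γ E F G else joinHull Γ E F H ∪ {e | e ∈ E ∧ ¬ Meets Γ G e}

theorem mem_piece_true {x : V} :
    x ∈ piece Γ E F G H true ↔ x ∈ F ∨ x ∈ G ∨ x ∈ E ∧ Meets Γ G x := mem_joinHull

theorem mem_piece_false {x : V} : x ∈ piece Γ E F G H false ↔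
    x ∈ F ∨ x ∈ H ∨ x ∈ E ∧ (Meets Γ H x ∨ ¬ Meets Γ G x) := by
  change x ∈ joinHull Γ E F H ∪ _ ↔ _
  rw [mem_union, mem_joinHull, mem_ofPred_eq]
  tauto

theorem isFoldGraph (h : IsUnfolding Γ E F G H a b c) :
    IsFoldGraph Γ (piece Γ E F G H) F (fun i => if i then a else b) c where
  inter v h1 h2 := by
    rw [mem_piece_true] at h1
    rw [mem_piece_false] at h2
    have := h.unique v
    have := h.disjEG v
    have := h.disjEH v
    have := h.disjGH v
    tauto
  subset i := by
    rintro x (rfl | hx)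
    · cases i
      · exact mem_piece_false.mpr (Or.inr (Or.inr ⟨h.cE, Or.inl h.cH⟩))
      · exact mem_piece_true.mpr (Or.inr (Or.inr ⟨h.cE, h.cG⟩))
    · cases i
      · exact mem_piece_false.mpr (Or.inl hx)
      · exact mem_piece_true.mpr (Or.inl hx)
  cover v := by
    by_contra hc
    push Not at hc
    have h1 := hc true
    have h2 := hc false
    rw [mem_piece_true] at h1
    rw [mem_piece_false] at h2
    have := h.cover v
    tauto
  edge u v huv := by
    by_contra hc
    push Not at hc
    have h1 := hc true
    have h2 := hc false
    rw [mem_piece_true, mem_piece_true] at h1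
    rw [mem_piece_false, mem_piece_false] at h2
    have e1 : v ∈ G → Meets Γ G u := fun hv => ⟨v, hv, huv⟩
    have e2 : v ∈ H → Meets Γ H u := fun hv => ⟨v, hv, huv⟩
    have e3 : u ∈ G → Meets Γ G v := fun hu => ⟨u, hu, huv.symm⟩
    have e4 : u ∈ H → Meets Γ H v := fun hu => ⟨u, hu, huv.symm⟩
    have i2 : u ∈ E → v ∉ E := fun hu hv => h.indep u hu v hv huv
    have s3 : u ∈ G → v ∉ H := fun hu hv => h.separated u hu v hv huv
    have s4 : v ∈ G → u ∉ H := fun hv hu => h.separated v hv u hu huv.symm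
    rcases h.cover u with hu | hu | hu | hu <;> rcases h.cover v with hv | hv | hv | hv <;>
      simp_all
  a_mem i := by
    cases i
    · exact mem_piece_false.mpr (Or.inr (Or.inr ⟨h.bE, Or.inr h.bG⟩))
    · exact mem_piece_true.mpr (Or.inr (Or.inr ⟨h.aE, h.aG⟩))
  a_ne i := by
    cases i
    · rintro rfl; exact h.bG h.cG
    · rintro rfl; exact h.aH h.cH
  not_adj i := by
    cases i
    · exact h.indep b h.bE c h.cE
    · exact h.indep a h.aE c h.cE
  adj_a i x hx := by
    cases i
    · exact (h.join b h.bE x hx).symm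
    · exact (h.join a h.aE x hx).symm
  adj_c x hx := (h.join c h.cE x hx).symm

theorem adj_of_adj_some (h : IsUnfolding Γ E F G H a b c) {x y : V}
    (hxy :
      (unfoldGraph Γ E F (joinHull Γ E F G) (joinHull Γ E F H) c).Adj (some x) (some y)) :
    Γ.Adj x y := by
  rw [unfoldGraph, SimpleGraph.fromRel_adj] at hxy
  rcases hxy.2 with h1 | h1 <;> cases h1
  · exact h.join _ ‹_› _ ‹_›
  · assumption
  · assumption
  · exact (h.join _ ‹_› _ ‹_›).symm
  · exact SimpleGraph.Adj.symm ‹_›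
  · exact SimpleGraph.Adj.symm ‹_›

theorem adj_none_some (h : IsUnfolding Γ E F G H a b c) {x : V}
    (hx : x ∈ piece Γ E F G H false) :
    (unfoldGraph Γ E F (joinHull Γ E F G) (joinHull Γ E F H) c).Adj none (some x) ↔ Γ.Adj c x := by
  have hc : c ∈ joinHull Γ E F H := mem_joinHull.mpr (Or.inr (Or.inr ⟨h.cE, h.cH⟩))
  rw [unfoldGraph, SimpleGraph.fromRel_adj]
  constructor
  · rintro ⟨-, h1 | h1⟩ <;> cases h1
    · exact h.join _ h.cE _ ‹_›
    · exact SimpleGraph.Adj.symm ‹_›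
  · intro hcx
    refine ⟨by simp, Or.inr (.right_new hcx.symm ?_ hc)⟩
    rw [mem_piece_false] at hx
    rw [mem_joinHull]
    have := fun hxE => h.indep c h.cE x hxE hcx
    tauto

theorem adj_some (h : IsUnfolding Γ E F G H a b c) {x y : V}
    (hx : x ∈ piece Γ E F G H false) (hy : y ∈ piece Γ E F G H false) (hxc : x ≠ c) (hyc : y ≠ c)
    (hxy : Γ.Adj x y) :
    (unfoldGraph Γ E F (joinHull Γ E F G) (joinHull Γ E F H) c).Adj (some x) (some y) := by
  rw [unfoldGraph, SimpleGraph.fromRel_adj]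
  refine ⟨by simpa using hxy.ne, ?_⟩
  by_cases h1 : x ∈ joinHull Γ E F H
  · by_cases h2 : y ∈ joinHull Γ E F H
    · exact Or.inl (.right hxy h1 h2 hxc hyc)
    · rw [mem_piece_false] at hy
      rw [mem_joinHull] at h1 h2
      have := fun hxE hyE => h.indep x hxE y hyE hxy
      have e : x ∈ H → Meets Γ H y := fun hx => ⟨x, hx, hxy.symm⟩
      exact Or.inr (.join (by tauto) (by tauto))
  · rw [mem_piece_false] at hx hy
    rw [mem_joinHull] at h1
    have := fun hxE hyE => h.indep x hxE y hyE hxy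
    have e : y ∈ H → Meets Γ H x := fun hx => ⟨y, hx, hxy⟩
    exact Or.inl (.join (by tauto) (by tauto))

theorem recolor_self : recolor c c = none := by simp [recolor]

theorem recolor_of_ne {x : V} (hx : x ≠ c) : recolor c x = some x := by simp [recolor, hx]

theorem recolor_injective : Function.Injective (recolor c) := by
  intro x y hxy
  by_cases hx : x = c <;> by_cases hy : y = c <;> simp_all [recolor]

theorem isGluing (h : IsUnfolding Γ E F G H a b c) :
    IsGluing Γ (piece Γ E F G H) F
      (unfoldGraph Γ E F (joinHull Γ E F G) (joinHull Γ E F H) c)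
      (fun i => if i then some else recolor c) where
  subset i := (subset_insert c F).trans (h.isFoldGraph.subset i)
  injOn i := by
    cases i
    · exact recolor_injective.injOn
    · exact (Option.some_injective V).injOn
  adj i x hx y hy := by
    cases i
    · simp only [Bool.false_eq_true, if_false]
      by_cases hxc : x = c
      · by_cases hyc : y = c
        · simp [hxc, hyc]
        · rw [hxc, recolor_self, recolor_of_ne hyc, h.adj_none_some hy]
      · by_cases hyc : y = c
        · rw [hyc, recolor_self, recolor_of_ne hxc, SimpleGraph.adj_comm, h.adj_none_some hx,
            SimpleGraph.adj_comm]
        · rw [recolor_of_ne hxc, recolor_of_ne hyc]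
          exact ⟨h.adj_of_adj_some, h.adj_some hx hy hxc hyc⟩
    · refine ⟨h.adj_of_adj_some, fun hxy => ?_⟩
      rw [unfoldGraph, SimpleGraph.fromRel_adj]
      exact ⟨by simpa using hxy.ne, Or.inl (.left hxy hx hy)⟩
  cover u := by
    cases u with
    | none => exact ⟨false, c, h.isFoldGraph.subset false (mem_insert _ _), recolor_self⟩
    | some x =>
      by_cases hx : x ∈ piece Γ E F G H true
      · exact ⟨true, x, hx, rfl⟩
      · obtain ⟨_ | _, hi⟩ := h.isFoldGraph.cover x
        · refine ⟨false, x, hi, recolor_of_ne ?_⟩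
          rintro rfl
          exact hx (h.isFoldGraph.subset true (mem_insert _ _))
        · exact absurd hi hx
  edge u v huv := by
    have key : ∀ u v, UnfoldRel Γ E F (joinHull Γ E F G) (joinHull Γ E F H) c u v →
        ∃ i, ∃ x ∈ piece Γ E F G H i, ∃ y ∈ piece Γ E F G H i,
          (if i then some else recolor c) x = u ∧ (if i then some else recolor c) y = v := by
      have hF : ∀ i, ∀ f ∈ F, f ∈ piece Γ E F G H i := fun i f hf =>
        h.isFoldGraph.subset i (mem_insert_of_mem _ hf)
      have hc : ∀ f ∈ F, f ≠ c := by rintro f hf rfl; exact h.disjEF _ h.cE hf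
      have hH : ∀ x ∈ joinHull Γ E F H, x ∈ piece Γ E F G H false := fun x hx => Or.inl hx
      rintro u v (⟨he, hf⟩ | hf | ⟨-, hx, hy⟩ | ⟨-, hx, hy, hxc, hyc⟩ | ⟨hxc, hx, hc'⟩)
      · rename_i e f
        by_cases hg : Meets Γ G e
        · exact ⟨true, e, mem_piece_true.mpr (Or.inr (Or.inr ⟨he, hg⟩)), f, hF _ f hf, rfl, rfl⟩
        · refine ⟨false, e, mem_piece_false.mpr (Or.inr (Or.inr ⟨he, Or.inr hg⟩)), f, hF _ f hf,
            recolor_of_ne ?_, recolor_of_ne (hc f hf)⟩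
          rintro rfl
          exact hg h.cG
      · exact ⟨false, c, h.isFoldGraph.subset false (mem_insert _ _), _, hF _ _ hf, recolor_self,
          recolor_of_ne (hc _ hf)⟩
      · exact ⟨true, _, hx, _, hy, rfl, rfl⟩
      · exact ⟨false, _, hH _ hx, _, hH _ hy, recolor_of_ne hxc, recolor_of_ne hyc⟩
      · exact ⟨false, _, hH _ hx, _, hH _ hc', recolor_of_ne hxc.ne, recolor_self⟩
    rw [unfoldGraph, SimpleGraph.fromRel_adj] at huv
    rcases huv.2 with h1 | h1
    · exact key u v h1
    · obtain ⟨i, x, hx, y, hy, h2, h3⟩ := key v u h1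
      exact ⟨i, y, hy, x, hx, h3, h2⟩
  overlap x hx y hy hxy := by
    have hyc : y ≠ c := by rintro rfl; simp [recolor] at hxy
    have hxy' : x = y := by simpa [recolor, hyc] using hxy
    subst hxy'
    exact ⟨rfl, (h.isFoldGraph.inter x hx hy).resolve_left hyc⟩
  agree x hx := by
    have hxc : x ≠ c := by rintro rfl; exact h.disjEF _ h.cE hx
    exact (recolor_of_ne hxc).symm

end IsUnfolding

theorem mainTheorem4 {V : Type*} [Finite V] (Γ : SimpleGraph V) (hΓ : Γ.CliqueFree 3)
    (E F G H Gbar Hbar A B C : Set V) (c : V)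
    (hEF : IsSeparatingJoin Γ E F)
    (hG : IsUnionOfComponents Γ (E ∪ F)ᶜ G)
    (hH : H = (E ∪ F)ᶜ \ G)
    (hGbar : Gbar = joinHull Γ E F G)
    (hHbar : Hbar = joinHull Γ E F H)
    (hA : A = E ∩ Gbar ∩ Hbarᶜ)
    (hB : B = E ∩ Gbarᶜ)
    (hC : C = E ∩ Gbar ∩ Hbar)
    (hA_ne : A.Nonempty) (hB_ne : B.Nonempty) (hCc : C = {c}) :
    ∃ f : RACG Γ → RACG (unfoldGraph Γ E F Gbar Hbar c),
      IsQuasiIsometry f ∧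
      CoarselyPreservesCopies Γ (unfoldGraph Γ E F Gbar Hbar c) Gbar some f ∧
      CoarselyPreservesCopies Γ (unfoldGraph Γ E F Gbar Hbar c) Hbar (recolor c) f := by
  subst hGbar hHbar
  obtain ⟨a, ha⟩ := hA_ne
  obtain ⟨b, hb⟩ := hB_ne
  obtain ⟨f₀, hf₀⟩ := hEF.right_nonempty
  have hEF' : ∀ v ∈ E, v ∉ F := fun v hv => disjoint_left.mp hEF.disjoint hv
  have hGsub : ∀ v ∈ G, v ∉ E ∧ v ∉ F := fun v hv => by simpa using hG.subset hv
  have hHsub : ∀ v, v ∈ H ↔ (v ∉ E ∧ v ∉ F) ∧ v ∉ G := fun v => by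
    rw [hH]; simp
  have hGE : ∀ v ∈ E, (v ∈ joinHull Γ E F G ↔ Meets Γ G v) := fun v hv => by
    rw [mem_joinHull]
    have h1 := hEF' v hv
    have h2 := hGsub v
    tauto
  have hHE : ∀ v ∈ E, (v ∈ joinHull Γ E F H ↔ Meets Γ H v) := fun v hv => by
    rw [mem_joinHull]
    have h1 := hEF' v hv
    have h2 := hHsub v
    tauto
  have hc : c ∈ E ∩ joinHull Γ E F G ∩ joinHull Γ E F H := by rw [← hC, hCc]; rfl
  rw [hA] at ha
  rw [hB] at hb
  have hU : IsUnfolding Γ E F G H a b c :=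
    { cover := fun v => by have := hHsub v; tauto
      disjEF := hEF'
      disjEG := fun v hv hg => (hGsub v hg).1 hv
      disjEH := fun v hv hh => ((hHsub v).mp hh).1.1 hv
      disjGH := fun v hg hh => ((hHsub v).mp hh).2 hg
      join := hEF.adj
      indep := fun x hx y hy => hΓ.not_adj_of_adj (hEF.adj x hx f₀ hf₀) (hEF.adj y hy f₀ hf₀)
      separated := fun x hx y hy hxy =>
        ((hHsub y).mp hy).2 (hG.mem_of_adj hx (by simpa using ((hHsub y).mp hy).1) hxy)
      aE := ha.1.1
      bE := hb.1
      cE := hc.1.1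
      aG := (hGE a ha.1.1).mp ha.1.2
      cG := (hGE c hc.1.1).mp hc.1.2
      cH := (hHE c hc.1.1).mp hc.2
      aH := fun h => ha.2 ((hHE a ha.1.1).mpr h)
      bG := fun h => hb.2 ((hGE b hb.1).mpr h)
      unique := fun x hx h1 h2 => by
        have : x ∈ C := by rw [hC]; exact ⟨⟨hx, (hGE x hx).mpr h1⟩, (hHE x hx).mpr h2⟩
        rwa [hCc] at this }
  obtain ⟨f, hf, hcopies⟩ := RACG.exists_quasiIsometry hU.isFoldGraph hU.isGluing
  exact ⟨f, hf, hcopies true _ Subset.rfl, hcopies false _ subset_union_left⟩
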